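/- Let $T>0$ and let $|\cdot|$ be the Euclidean norm on $\mathbf R^n$. Call $\omega:[0,\infty)\to[0,\infty)$ a *modulus* if it is non-decreasing and $0=\omega(0)=\lim_{r\to0}\omega(r)$. **Hypotheses on the data.** * $H_1\in C(\mathbf R^n\times[0,T]\times\mathbf R^n)$ satisfies $H_1(x,t,\lambda p)=\lambda H_1(x,t,p)$ for all $\lambda>0$; there are $L_1,L_2>0$ with $|H_1(x,t,p)-H_1(y,t,p)|\le L_1|x-y|$ whenever $|p|=1$, and $|H_1(x,t,p)-H_1(x,t,q)|\le L_2|p-q|$ for all $p,q$; and $\sup_{|p|=1}|H_1(x,t,p)|<\infty$, the supremum being over all $x\in\mathbf R^n$, $t\in[0,T]$ and $|p|=1$. * $\beta:\mathbf R\to\mathbf R$ is Lipschitz continuous, non-decreasing and bounded, with $\beta(0)=0$, $\beta(r)>0$ for $r>0$ and $\beta(r)<0$ for $r<0$. * $G:\mathbf R^n\times\mathbf R^n\to\mathbf R$ is bounded from above; for every $R\ge0$ there is a modulus $\omega_R$ with $|G(x,p)-G(x,q)|\le\omega_R(|p-q|)$ for all $x$ and all $|p|,|q|\le R$; and there is a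 modulus $\omega$ with $|G(x,p)-G(y,p)|\le\omega(|x-y|(1+|p|))$ for all $x,y,p$. * $u_0:\mathbf R^n\to\mathbf R$ is uniformly continuous. **Viscosity solutions.** For $v:\mathbf R^n\times[0,T)\to\mathbf R$ let $v^*$ and $v_*$ be its upper and lower semicontinuous envelopes. For a continuous $F$, a *viscosity solution* of $$v_t=F(x,t,v,\nabla v)\ \text{ in }\mathbf R^n\times(0,T),\qquad v(\cdot,0)=u_0,$$ is a function $v$ such that: * $v^*<\infty$, and $\phi_t\le F(\cdot,\cdot,\phi,\nabla\phi)$ at $P_0$ whenever $P_0\in\mathbf R^n\times(0,T)$, $\phi\in C^1(\mathbf R^n\times(0,T))$, $v^*\le\phi$ near $P_0$ and $v^*(P_0)=\phi(P_0)$; * $v_*>-\infty$, and $\phi_t\ge F(\cdot,\cdot,\phi,\nabla\phi)$ at $P_0$ whenever $P_0\in\mathbf R^n\times(0,T)$, $\phi\in C^1(\mathbf R^n\times(0,T))$, $v_*\ge\phi$ near $P_0$ and $v_*(P_0)=\phi(P_0)$; * $v^*(x,0)=v_*(x,0)=v(x,0)=u_0(x)$ for all $x\in\mathbf R^n$; *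 $|v(x,t)|\le K(1+|x|)$ on $\mathbf R^n\times(0,T)$ for some constant $K$. **Theorem (Preservation of the zero level set).** Let $w$ and $u$ be, respectively, viscosity solutions of $$w_t=H_1(x,t,\nabla w),\quad w(\cdot,0)=u_0,\qquad\text{and}\qquad u_t=H_1(x,t,\nabla u)+\beta(u)\,G(x,\nabla u),\quad u(\cdot,0)=u_0 .$$ Assume that either 1. $G$ is bounded from below on $\mathbf R^n\times\mathbf R^n$, or 2. $G$ is bounded from below on $\mathbf R^n\times\{|p|\le\rho\}$ for some $\rho\in(0,1]$, and $w$ is Lipschitz continuous in $x$ uniformly in $t\in[0,T)$. Then for all $t\in(0,T)$ $$\{x: u(x,t)=0\}=\{x: w(x,t)=0\},\qquad \{x:\pm u(x,t)>0\}=\{x:\pm w(x,t)>0\}.$$ -/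

import Mathlib

open Set Filter Topology
open scoped NNReal

namespace LevelSetFlow

/-- The Euclidean space `ℝⁿ`. -/
abbrev Space (n : ℕ) : Type := EuclideanSpace ℝ (Fin n)

/-- A modulus: a non-decreasing `ω : [0,∞) → [0,∞)` with `ω(0) = 0 = lim_{r → 0} ω(r)`. -/
structure IsModulus (ω : ℝ≥0 → ℝ≥0) : Prop where
  mono : Monotone ω
  map_zero : ω 0 = 0
  tendsto_zero : Tendsto ω (𝓝 0) (𝓝 0)

/-- The assumptions on the geometric Hamiltonian `H₁ : ℝⁿ × [0,T] × ℝⁿ → ℝ`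
(values for `t` outside `[0,T]` play no role). -/
structure IsGeometricHamiltonian {n : ℕ} (T : ℝ) (H₁ : Space n → ℝ → Space n → ℝ) : Prop where
  continuousOn : ContinuousOn (fun q : Space n × ℝ × Space n => H₁ q.1 q.2.1 q.2.2)
    (univ ×ˢ (Icc 0 T ×ˢ univ))
  homogeneous : ∀ c : ℝ, 0 < c → ∀ x : Space n, ∀ t ∈ Icc 0 T, ∀ p : Space n,
    H₁ x t (c • p) = c * H₁ x t p
  lipschitz_space : ∃ L₁ : ℝ, 0 < L₁ ∧ ∀ x y : Space n, ∀ t ∈ Icc 0 T, ∀ p : Space n, ‖p‖ = 1 →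
    |H₁ x t p - H₁ y t p| ≤ L₁ * ‖x - y‖
  lipschitz_gradient : ∃ L₂ : ℝ, 0 < L₂ ∧ ∀ x : Space n, ∀ t ∈ Icc 0 T, ∀ p q : Space n,
    |H₁ x t p - H₁ x t q| ≤ L₂ * ‖p - q‖
  bounded_sphere : ∃ C : ℝ, ∀ x : Space n, ∀ t ∈ Icc 0 T, ∀ p : Space n, ‖p‖ = 1 →
    |H₁ x t p| ≤ C

/-- The assumptions on `β`: Lipschitz, non-decreasing, bounded, with the sign of its argument. -/
structure IsSmoothedSign (β : ℝ → ℝ) : Prop where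
  lipschitz : ∃ L : ℝ≥0, LipschitzWith L β
  mono : Monotone β
  bounded : ∃ C : ℝ, ∀ r : ℝ, |β r| ≤ C
  map_zero : β 0 = 0
  pos : ∀ r : ℝ, 0 < r → 0 < β r
  neg : ∀ r : ℝ, r < 0 → β r < 0

/-- The assumptions on `G : ℝⁿ × ℝⁿ → ℝ`: uniform continuity in `p` on bounded sets of `p`,
a modulus in `x` controlled by `|x - y| (1 + |p|)`, and boundedness from above. -/
structure IsCorrector {n : ℕ} (G : Space n → Space n → ℝ) : Prop where
  modulus_gradient : ∀ R : ℝ, 0 ≤ R → ∃ ω : ℝ≥0 → ℝ≥0, IsModulus ω ∧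
    ∀ x p q : Space n, ‖p‖ ≤ R → ‖q‖ ≤ R → |G x p - G x q| ≤ ω ‖p - q‖₊
  modulus_space : ∃ ω : ℝ≥0 → ℝ≥0, IsModulus ω ∧
    ∀ x y p : Space n, |G x p - G y p| ≤ ω (‖x - y‖₊ * (1 + ‖p‖₊))
  bounded_above : ∃ C : ℝ, ∀ x p : Space n, G x p ≤ C

/-- The space-time domain `ℝⁿ × [0,T)`. -/
def cylinder (n : ℕ) (T : ℝ) : Set (Space n × ℝ) := univ ×ˢ Ico 0 T

/-- The upper semicontinuous envelope `u^*` of `u : ℝⁿ × [0,T) → ℝ`, with values in `[-∞,∞]`. -/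
noncomputable def upperEnvelope {n : ℕ} (T : ℝ) (u : Space n → ℝ → ℝ) (P : Space n × ℝ) : EReal :=
  limsup (fun Q : Space n × ℝ => (u Q.1 Q.2 : EReal)) (𝓝[cylinder n T] P)

/-- The lower semicontinuous envelope `u_*` of `u : ℝⁿ × [0,T) → ℝ`, with values in `[-∞,∞]`. -/
noncomputable def lowerEnvelope {n : ℕ} (T : ℝ) (u : Space n → ℝ → ℝ) (P : Space n × ℝ) : EReal :=
  liminf (fun Q : Space n × ℝ => (u Q.1 Q.2 : EReal)) (𝓝[cylinder n T] P)

/-- `u` is a viscosity subsolution of `u_t = F(x,t,u,∇u)` in `ℝⁿ × (0,T)`, for continuous `F`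
(so that `F` is its own semicontinuous envelope). -/
def IsViscositySubsolution {n : ℕ} (T : ℝ) (F : Space n → ℝ → ℝ → Space n → ℝ)
    (u : Space n → ℝ → ℝ) : Prop :=
  (∀ P ∈ cylinder n T, upperEnvelope T u P < ⊤) ∧
  ∀ φ : Space n × ℝ → ℝ, ContDiffOn ℝ 1 φ (univ ×ˢ Ioo 0 T) →
    ∀ (x₀ : Space n) (t₀ : ℝ), t₀ ∈ Ioo 0 T →
      (∀ᶠ P in 𝓝 (x₀, t₀), upperEnvelope T u P ≤ (φ P : EReal)) →
      upperEnvelope T u (x₀, t₀) = (φ (x₀, t₀) : EReal) →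
      deriv (fun t => φ (x₀, t)) t₀ ≤
        F x₀ t₀ (φ (x₀, t₀)) (gradient (fun x => φ (x, t₀)) x₀)

/-- `u` is a viscosity supersolution of `u_t = F(x,t,u,∇u)` in `ℝⁿ × (0,T)`, for continuous `F`
(so that `F` is its own semicontinuous envelope). -/
def IsViscositySupersolution {n : ℕ} (T : ℝ) (F : Space n → ℝ → ℝ → Space n → ℝ)
    (u : Space n → ℝ → ℝ) : Prop :=
  (∀ P ∈ cylinder n T, ⊥ < lowerEnvelope T u P) ∧
  ∀ φ : Space n × ℝ → ℝ, ContDiffOn ℝ 1 φ (univ ×ˢ Ioo 0 T) →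
    ∀ (x₀ : Space n) (t₀ : ℝ), t₀ ∈ Ioo 0 T →
      (∀ᶠ P in 𝓝 (x₀, t₀), (φ P : EReal) ≤ lowerEnvelope T u P) →
      lowerEnvelope T u (x₀, t₀) = (φ (x₀, t₀) : EReal) →
      F x₀ t₀ (φ (x₀, t₀)) (gradient (fun x => φ (x, t₀)) x₀) ≤
        deriv (fun t => φ (x₀, t)) t₀

/-- `u : ℝⁿ × [0,T) → ℝ` is a viscosity solution of the Cauchy problem
`u_t = F(x,t,u,∇u)` in `ℝⁿ × (0,T)`, `u(·,0) = u₀`, in the class of functions of at most linear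
growth in which the solution is unique. The datum is attained continuously, that is,
`u^*(x,0) = u_*(x,0) = u₀(x)`; continuity of `u` for positive times is not required. -/
structure IsViscositySolution {n : ℕ} (T : ℝ) (F : Space n → ℝ → ℝ → Space n → ℝ)
    (u₀ : Space n → ℝ) (u : Space n → ℝ → ℝ) : Prop where
  sub : IsViscositySubsolution T F u
  super : IsViscositySupersolution T F u
  initial : ∀ x : Space n, u x 0 = u₀ x
  continuous_initial : ∀ x : Space n,
    ContinuousWithinAt (fun Q : Space n × ℝ => u Q.1 Q.2) (cylinder n T) (x, 0)
  linear_growth : ∃ K : ℝ, ∀ x : Space n, ∀ t ∈ Ioo 0 T, |u x t| ≤ K * (1 + ‖x‖)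

/-- The interface `Γ_t = {w(·,t) = 0}`. -/
def interface {n : ℕ} (w : Space n → ℝ → ℝ) (t : ℝ) : Set (Space n) := {x | w x t = 0}

/-- The positive phase `D_t^+ = {w(·,t) > 0}`. -/
def positivePhase {n : ℕ} (w : Space n → ℝ → ℝ) (t : ℝ) : Set (Space n) := {x | 0 < w x t}

/-- The negative phase `D_t^- = {w(·,t) < 0}`. -/
def negativePhase {n : ℕ} (w : Space n → ℝ → ℝ) (t : ℝ) : Set (Space n) := {x | w x t < 0}

end LevelSetFlow

open LevelSetFlow

/-! Since `β` is Lipschitz and vanishes at `0`, the term `β(u) G` has size `O(|u|)` in each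
direction in which `G` is bounded. It can change the size of a solution by an exponential factor,
but not its sign. The reflection `u ↦ -u` preserves the structure of the problem, so it is enough to
match the positive phases; the zero sets are then the complements.

The core is `pos_of_pos`: if `v_t ≤ H₁ + Kv v` where `v > 0`, and `z_t ≥ H₁ - Kz |z|`, with equal
data, then `v > 0` forces `z > 0`. By homogeneity of `H₁`, the function `V = η exp(-(Kv + Kz) t)
v^*` satisfies `V_t ≤ H₁(∇V) - Kz V` where `V > 0`. A geometric equation also tolerates an
increasing change of unknown, so `Z = softPlus δ (z_*)`, a positive function, satisfies `Z_t ≥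
H₁(∇Z) - Kz Z`. For `η ≤ 1` the data are ordered, and comparison gives `V ≤ Z`. Where `z_* ≤ 0` one
has `Z ≤ δ`, which is impossible once `δ < V`.

When `G` is bounded below only for small gradients, that bound is used only where `z_* ≥ 0`;
elsewhere `β ≤ 0` and the upper bound serves. If `v` is Lipschitz in space, a small `η` makes the
relevant gradients small.

Comparison (`sub_le_penalty`, `le_of_subsolution_of_supersolution`) is proved by doubling variables.
Positivity of `Z` bounds the doubled function without a growth condition on `Z`, and a compactness
argument at the initial time replaces a uniform modulus of the data. -/

namespace LevelSetFlow

/-! ### First-order jets and their transformation rules. -/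

section

variable {n : ℕ}

/-- `(a, p)` is a first-order superjet of `V` at `P`: the time derivative and the space gradient
of a `C¹` function touching `V` from above at `P`, up to an additive constant. -/
def HasSuperjet (V : Space n × ℝ → ℝ) (P : Space n × ℝ) (a : ℝ) (p : Space n) : Prop :=
  ∃ φ : Space n × ℝ → ℝ, ContDiffAt ℝ 1 φ P ∧ IsLocalMax (fun Q => V Q - φ Q) P ∧
    HasDerivAt (fun t => φ (P.1, t)) a P.2 ∧ HasGradientAt (fun x => φ (x, P.2)) p P.1

/-- `(a, p)` is a first-order subjet of `Z` at `P`. -/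
def HasSubjet (Z : Space n × ℝ → ℝ) (P : Space n × ℝ) (a : ℝ) (p : Space n) : Prop :=
  HasSuperjet (fun Q => -Z Q) P (-a) (-p)

/-- Jets use test functions that are `C¹` near one point, while the definition of solution asks for
`C¹` on the whole slab. A bump function bridges the two. -/
theorem exists_contDiff_eventuallyEq {E : Type*} [NormedAddCommGroup E] [NormedSpace ℝ E]
    [FiniteDimensional ℝ E] {φ : E → ℝ} {P : E} (h : ContDiffAt ℝ 1 φ P) :
    ∃ ψ : E → ℝ, ContDiff ℝ 1 ψ ∧ ψ =ᶠ[𝓝 P] φ := by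
  have h1 := h.eventually (by simp)
  obtain ⟨r, hr, hball⟩ := Metric.eventually_nhds_iff_ball.1 h1
  let χ : ContDiffBump P := ⟨r / 4, r / 2, by positivity, by linarith⟩
  refine ⟨fun Q => χ Q * φ Q, contDiff_iff_contDiffAt.2 fun x => ?_, ?_⟩
  · by_cases hx : x ∈ tsupport (fun Q => χ Q * φ Q)
    swap
    · exact (contDiffAt_const (c := (0 : ℝ))).congr_of_eventuallyEq
        (notMem_tsupport_iff_eventuallyEq.1 hx)
    have hx' : x ∈ tsupport χ := tsupport_mul_subset_left (f := χ) (g := φ) hx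
    rw [χ.tsupport_eq] at hx'
    exact χ.contDiff.contDiffAt.mul (hball x (Metric.closedBall_subset_ball (by
      change r / 2 < r; linarith) hx'))
  · filter_upwards [χ.eventuallyEq_one] with Q hQ
    rw [hQ]; simp

theorem IsViscositySubsolution.le_of_hasSuperjet {T : ℝ} {F : Space n → ℝ → ℝ → Space n → ℝ}
    {u : Space n → ℝ → ℝ} (hu : IsViscositySubsolution T F u) {V : Space n × ℝ → ℝ}
    (hV : ∀ P ∈ cylinder n T, upperEnvelope T u P = (V P : EReal)) {P : Space n × ℝ}
    (hP : P.2 ∈ Ioo 0 T) {a : ℝ} {p : Space n} (hj : HasSuperjet V P a p) :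
    a ≤ F P.1 P.2 (V P) p := by
  obtain ⟨φ, hφ, hmax, ha, hp⟩ := hj
  obtain ⟨ψ, hψ, hψφ⟩ := exists_contDiff_eventuallyEq hφ
  have hPe : ψ P = φ P := hψφ.eq_of_nhds
  have hcyl : ∀ᶠ Q in 𝓝 P, Q ∈ cylinder n T := by
    have : ∀ᶠ Q : Space n × ℝ in 𝓝 P, Q.2 ∈ Ioo 0 T :=
      continuous_snd.continuousAt.eventually (isOpen_Ioo.mem_nhds hP)
    filter_upwards [this] with Q hQ
    exact ⟨mem_univ _, hQ.1.le, hQ.2⟩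
  have key := hu.2 (fun Q => ψ Q + (V P - φ P)) (hψ.add contDiff_const).contDiffOn P.1 P.2 hP ?_ ?_
  · have hc1 : Tendsto (fun t : ℝ => (P.1, t)) (𝓝 P.2) (𝓝 P) :=
      (Continuous.prodMk_right P.1).continuousAt
    have hc2 : Tendsto (fun x : Space n => (x, P.2)) (𝓝 P.1) (𝓝 P) :=
      (Continuous.prodMk_left P.2).continuousAt
    have e1 : HasDerivAt (fun t => ψ (P.1, t) + (V P - φ P)) a P.2 :=
      (ha.congr_of_eventuallyEq (hc1.eventually hψφ)).add_const _
    have e2 : HasGradientAt (fun x => ψ (x, P.2) + (V P - φ P)) p P.1 := by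
      have := hp.congr_of_eventuallyEq (hc2.eventually hψφ)
      rw [hasGradientAt_iff_hasFDerivAt] at this ⊢
      exact this.add_const _
    rw [e1.deriv, e2.gradient] at key
    simpa [hPe] using key
  · filter_upwards [hcyl, hmax, hψφ] with Q hQ hm he
    rw [hV Q hQ, EReal.coe_le_coe_iff, he]
    linarith
  · rw [hV _ hcyl.self_of_nhds]
    simp [hPe]

/-- Moving from `P` by `-s p`, the test function drops by about `s ‖p‖²`, and by no more than `V`
does, hence by at most `L s ‖p‖`. -/
theorem HasSuperjet.norm_le {V : Space n × ℝ → ℝ} {P : Space n × ℝ} {a : ℝ} {p : Space n}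
    (hj : HasSuperjet V P a p) {L : ℝ} (hL : 0 ≤ L)
    (hV : ∀ x, V P - V (x, P.2) ≤ L * ‖P.1 - x‖) : ‖p‖ ≤ L := by
  obtain ⟨φ, -, hmax, -, hp⟩ := hj
  have hc2 : Tendsto (fun x : Space n => (x, P.2)) (𝓝 P.1) (𝓝 P) :=
      (Continuous.prodMk_left P.2).continuousAt
  have hm := hc2.eventually hmax
  have hline : HasDerivAt (fun s : ℝ => P.1 - s • p) (-p) 0 := by
    simpa using ((hasDerivAt_id (0 : ℝ)).smul_const p).const_sub P.1
  have hp' : HasFDerivAt (fun x => φ (x, P.2)) (InnerProductSpace.toDual ℝ (Space n) p)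
      (P.1 - (0 : ℝ) • p) := by
    simpa using hp.hasFDerivAt
  have hd := hp'.comp_hasDerivAt (0 : ℝ) hline
  have hd' : HasDerivAt (fun s : ℝ => φ (P.1 - s • p, P.2) + L * ‖p‖ * s)
      (-‖p‖ ^ 2 + L * ‖p‖) 0 := by
    refine HasDerivAt.congr_deriv (hd.add ((hasDerivAt_id (0 : ℝ)).const_mul (L * ‖p‖))) ?_
    simp
  have hnn : 0 ≤ -‖p‖ ^ 2 + L * ‖p‖ := by
    by_contra! hneg
    have hcl : Tendsto (fun s : ℝ => P.1 - s • p) (𝓝 0) (𝓝 P.1) := by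
      simpa using hline.continuousAt.tendsto
    have h1 := (hcl.eventually hm).filter_mono (nhdsWithin_le_nhds (s := Ioi 0))
    have h2 := (hd'.tendsto_slope_zero_right.eventually (gt_mem_nhds hneg))
    obtain ⟨s, hs1, hs2, hs3⟩ := (h1.and (h2.and self_mem_nhdsWithin)).exists
    have hs : 0 < s := hs3
    have hb := hV (P.1 - s • p)
    have hn : ‖P.1 - (P.1 - s • p)‖ = s * ‖p‖ := by
      rw [sub_sub_cancel, norm_smul, Real.norm_of_nonneg hs.le]
    rw [hn] at hb
    simp only [zero_add, zero_smul, sub_zero, mul_zero, add_zero, smul_eq_mul] at hs2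
    have : φ (P.1 - s • p, P.2) + L * ‖p‖ * s - φ (P.1, P.2) < 0 := by
      by_contra! hc
      exact absurd hs2 (not_lt.2 (mul_nonneg (inv_nonneg.2 hs.le) hc))
    have hP : (P.1, P.2) = P := rfl
    rw [hP] at this
    linarith
  by_contra! hlt
  have : 0 < ‖p‖ := hL.trans_lt hlt
  nlinarith

theorem HasSuperjet.of_exp_mul {U : Space n × ℝ → ℝ} {P : Space n × ℝ} {a : ℝ} {p : Space n}
    {c K : ℝ} (hc : 0 < c)
    (hj : HasSuperjet (fun Q => c * Real.exp (-K * Q.2) * U Q) P a p) :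
    HasSuperjet U P ((c * Real.exp (-K * P.2))⁻¹ * a + K * U P)
      ((c * Real.exp (-K * P.2))⁻¹ • p) := by
  obtain ⟨φ, hφ, hmax, ha, hp⟩ := hj
  set b : ℝ → ℝ := fun t => c * Real.exp (-K * t) with hb
  have hbpos : ∀ t, 0 < b t := fun t => mul_pos hc (Real.exp_pos _)
  have hbinv : ∀ t, (b t)⁻¹ = c⁻¹ * Real.exp (K * t) := fun t => by
    simp only [hb, mul_inv, ← Real.exp_neg, neg_mul, neg_neg]
  -- Dividing by a time-dependent factor preserves touching only if the two functions agree at `P`,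
  -- so the test function is first shifted by `C`.
  set C := b P.2 * U P - φ P with hC
  refine ⟨fun Q => (φ Q + C) * (b Q.2)⁻¹, ?_, ?_, ?_, ?_⟩
  · simp only [hbinv]
    exact (hφ.add contDiffAt_const).mul (by fun_prop)
  · filter_upwards [hmax] with Q hQ
    have e0 : (φ P + C) * (b P.2)⁻¹ = U P := by
      rw [hC]; field_simp [(hbpos P.2).ne']; ring
    have e1 : U Q ≤ (φ Q + C) * (b Q.2)⁻¹ := by
      rw [← div_eq_mul_inv, le_div_iff₀ (hbpos _)]
      linarith
    simp only [e0]
    linarith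
  · have h1 : HasDerivAt (fun t => (b t)⁻¹) (K * (b P.2)⁻¹) P.2 := by
      simp only [hbinv]
      have := (((hasDerivAt_id P.2).const_mul K).exp).const_mul c⁻¹
      refine this.congr_deriv ?_
      simp; ring
    have h2 := (ha.add_const C).mul h1
    refine h2.congr_deriv ?_
    change a * (b P.2)⁻¹ + (φ P + C) * (K * (b P.2)⁻¹) = (b P.2)⁻¹ * a + K * U P
    have := (hbpos P.2).ne'
    rw [hC]; field_simp; ring
  · rw [hasGradientAt_iff_hasFDerivAt] at hp ⊢
    have := (hp.add_const C).mul_const (b P.2)⁻¹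
    simpa [hb] using this

/-- Here `g` inverts `θ`. A test function `ψ` touching `θ ∘ W` from below is positive near `P`, so
`g ∘ ψ` is defined there and touches `W` from below. -/
theorem HasSubjet.of_comp {W : Space n × ℝ → ℝ} {θ g g' : ℝ → ℝ} {P : Space n × ℝ} {a : ℝ}
    {p : Space n} (hg : ContDiffOn ℝ 1 g (Ioi 0)) (hg' : ∀ z, 0 < z → HasDerivAt g (g' z) z)
    (hmono : MonotoneOn g (Ioi 0)) (hθ : ∀ r, 0 < θ r) (hgθ : ∀ r, g (θ r) = r)
    (hj : HasSubjet (fun Q => θ (W Q)) P a p) :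
    HasSubjet W P (g' (θ (W P)) * a) (g' (θ (W P)) • p) := by
  obtain ⟨φ, hφ, hmax, ha, hp⟩ := hj
  set C := θ (W P) + φ P with hC
  have hz : C - φ P = θ (W P) := by rw [hC]; ring
  have hz' : C - φ (P.1, P.2) = θ (W P) := hz
  have hd : HasDerivAt g (g' (θ (W P))) (C - φ P) := by rw [hz]; exact hg' _ (hθ _)
  refine ⟨fun Q => -g (C - φ Q), ?_, ?_, ?_, ?_⟩
  · refine ContDiffAt.neg (ContDiffAt.comp P ?_ (contDiffAt_const.sub hφ))
    rw [hz]
    exact hg.contDiffAt (isOpen_Ioi.mem_nhds (hθ _))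
  · have hpos : ∀ᶠ Q in 𝓝 P, 0 < C - φ Q :=
      (continuousAt_const.sub hφ.continuousAt).eventually (lt_mem_nhds (hz.symm ▸ hθ (W P) : 0 < C - φ P))
    filter_upwards [hmax, hpos] with Q hQ hQ0
    have h1 : g (C - φ Q) ≤ g (θ (W Q)) := hmono hQ0 (hθ _) (by linarith)
    rw [hgθ] at h1
    simp only [hz, hgθ]
    linarith
  · have := (HasDerivAt.comp P.2 (h := fun t => C - φ (P.1, t)) (h₂ := g) hd (ha.const_sub C)).neg
    exact this.congr_deriv (by ring)
  · rw [hasGradientAt_iff_hasFDerivAt] at hp ⊢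
    have := (HasDerivAt.comp_hasFDerivAt P.1 (f := fun x => C - φ (x, P.2)) (h₂ := g) hd
      (hp.const_sub C)).neg
    refine this.congr_fderiv ?_
    simp

end

/-! ### Real-valued envelopes and reflection of solutions. -/

section

variable {n : ℕ} {T M : ℝ} {u : Space n → ℝ → ℝ}

theorem le_upperEnvelope {P : Space n × ℝ} (hP : P ∈ cylinder n T) :
    (u P.1 P.2 : EReal) ≤ upperEnvelope T u P := by
  by_contra! h
  exact lt_irrefl _ ((eventually_lt_of_limsup_lt h).self_of_nhdsWithin hP)

theorem upperEnvelope_le {P : Space n × ℝ} {c : EReal}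
    (h : ∀ᶠ Q in 𝓝[cylinder n T] P, (u Q.1 Q.2 : EReal) ≤ c) : upperEnvelope T u P ≤ c :=
  limsup_le_of_le (h := h)

/-- The upper semicontinuous envelope as a real-valued function. -/
noncomputable def realEnvelope (T : ℝ) (u : Space n → ℝ → ℝ) (P : Space n × ℝ) : ℝ :=
  (upperEnvelope T u P).toReal

theorem upperEnvelope_le_of_growth (hu : ∀ Q ∈ cylinder n T, |u Q.1 Q.2| ≤ M * (1 + ‖Q.1‖))
    (P : Space n × ℝ) : upperEnvelope T u P ≤ (M * (1 + ‖P.1‖) : ℝ) := by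
  have hc : Continuous fun Q : Space n × ℝ => M * (1 + ‖Q.1‖) := by fun_prop
  refine EReal.le_of_forall_lt_iff_le.1 fun c hc' => ?_
  refine upperEnvelope_le ?_
  have h1 : ∀ᶠ Q in 𝓝[cylinder n T] P, M * (1 + ‖Q.1‖) < c :=
    (hc.continuousAt.eventually (gt_mem_nhds (EReal.coe_lt_coe_iff.1 hc'))).filter_mono
      nhdsWithin_le_nhds
  filter_upwards [h1, self_mem_nhdsWithin] with Q hQ hQc
  exact EReal.coe_le_coe_iff.2 (((le_abs_self _).trans (hu Q hQc)).trans hQ.le)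

theorem coe_realEnvelope (hu : ∀ Q ∈ cylinder n T, |u Q.1 Q.2| ≤ M * (1 + ‖Q.1‖))
    {P : Space n × ℝ} (hP : P ∈ cylinder n T) :
    upperEnvelope T u P = (realEnvelope T u P : EReal) :=
  (EReal.coe_toReal ((upperEnvelope_le_of_growth hu P).trans_lt (EReal.coe_lt_top _)).ne
    ((EReal.bot_lt_coe _).trans_le (le_upperEnvelope hP)).ne').symm

theorem le_realEnvelope (hu : ∀ Q ∈ cylinder n T, |u Q.1 Q.2| ≤ M * (1 + ‖Q.1‖))
    {P : Space n × ℝ} (hP : P ∈ cylinder n T) : u P.1 P.2 ≤ realEnvelope T u P := by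
  have := le_upperEnvelope (u := u) hP
  rwa [coe_realEnvelope hu hP, EReal.coe_le_coe_iff] at this

theorem realEnvelope_le (hu : ∀ Q ∈ cylinder n T, |u Q.1 Q.2| ≤ M * (1 + ‖Q.1‖))
    {P : Space n × ℝ} (hP : P ∈ cylinder n T) {c : ℝ}
    (h : ∀ᶠ Q in 𝓝[cylinder n T] P, u Q.1 Q.2 ≤ c) : realEnvelope T u P ≤ c := by
  have := upperEnvelope_le (u := u) (T := T) (P := P) (c := c)
    (h.mono fun Q hQ => EReal.coe_le_coe_iff.2 hQ)
  rwa [coe_realEnvelope hu hP, EReal.coe_le_coe_iff] at this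

theorem eventually_lt_of_realEnvelope_lt
    (hu : ∀ Q ∈ cylinder n T, |u Q.1 Q.2| ≤ M * (1 + ‖Q.1‖))
    {P : Space n × ℝ} (hP : P ∈ cylinder n T) {c : ℝ} (h : realEnvelope T u P < c) :
    ∀ᶠ Q in 𝓝[cylinder n T] P, u Q.1 Q.2 < c := by
  have h' : upperEnvelope T u P < (c : EReal) := by
    rwa [coe_realEnvelope hu hP, EReal.coe_lt_coe_iff]
  exact (eventually_lt_of_limsup_lt h').mono fun Q hQ => EReal.coe_lt_coe_iff.1 hQ

theorem realEnvelope_le_growth (hu : ∀ Q ∈ cylinder n T, |u Q.1 Q.2| ≤ M * (1 + ‖Q.1‖))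
    {P : Space n × ℝ} (hP : P ∈ cylinder n T) : realEnvelope T u P ≤ M * (1 + ‖P.1‖) := by
  have := upperEnvelope_le_of_growth hu P
  rwa [coe_realEnvelope hu hP, EReal.coe_le_coe_iff] at this

theorem upperSemicontinuousOn_realEnvelope
    (hu : ∀ Q ∈ cylinder n T, |u Q.1 Q.2| ≤ M * (1 + ‖Q.1‖)) :
    UpperSemicontinuousOn (realEnvelope T u) (cylinder n T) := by
  intro P hP c hc
  obtain ⟨c', h1, h2⟩ := exists_between hc
  have h3 := eventually_eventually_nhdsWithin.2 (eventually_lt_of_realEnvelope_lt hu hP h1)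
  filter_upwards [h3, self_mem_nhdsWithin] with Q hQ hQc
  exact (realEnvelope_le hu hQc (hQ.mono fun _ h => h.le)).trans_lt h2

theorem realEnvelope_eq_of_continuousWithinAt
    (hu : ∀ Q ∈ cylinder n T, |u Q.1 Q.2| ≤ M * (1 + ‖Q.1‖))
    {P : Space n × ℝ} (hP : P ∈ cylinder n T)
    (hc : ContinuousWithinAt (fun Q : Space n × ℝ => u Q.1 Q.2) (cylinder n T) P) :
    realEnvelope T u P = u P.1 P.2 := by
  refine le_antisymm (le_of_forall_gt fun c h => ?_) (le_realEnvelope hu hP)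
  obtain ⟨c', h1, h2⟩ := exists_between h
  exact (realEnvelope_le hu hP ((hc.eventually (gt_mem_nhds h1)).mono fun _ h => h.le)).trans_lt h2

/-- The cylinder is invariant under space translations, so neighbourhoods of `(x, P.2)` are carried
to neighbourhoods of `P` by a shift which changes `u` by at most `L ‖P.1 - x‖`. -/
theorem realEnvelope_sub_le (hu : ∀ Q ∈ cylinder n T, |u Q.1 Q.2| ≤ M * (1 + ‖Q.1‖))
    {L : ℝ≥0} (hL : ∀ t ∈ Ico 0 T, LipschitzWith L (fun x => u x t))
    {P : Space n × ℝ} (hP : P ∈ cylinder n T) (x : Space n) :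
    realEnvelope T u P - realEnvelope T u (x, P.2) ≤ L * ‖P.1 - x‖ := by
  rw [sub_le_iff_le_add']
  refine le_of_forall_gt fun c h => ?_
  obtain ⟨c', h1, h2⟩ := exists_between h
  have hx : ((x, P.2) : Space n × ℝ) ∈ cylinder n T := ⟨mem_univ _, hP.2⟩
  have h3 := eventually_lt_of_realEnvelope_lt hu hx (c := c' - L * ‖P.1 - x‖) (by linarith)
  have hc : Tendsto (fun Q : Space n × ℝ => (Q.1 + (x - P.1), Q.2)) (𝓝[cylinder n T] P)
      (𝓝[cylinder n T] (x, P.2)) := by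
    refine tendsto_nhdsWithin_iff.2 ⟨?_, ?_⟩
    · have : Continuous (fun Q : Space n × ℝ => (Q.1 + (x - P.1), Q.2)) := by fun_prop
      refine (this.tendsto' P _ ?_).mono_left nhdsWithin_le_nhds
      simp
    · filter_upwards [self_mem_nhdsWithin] with Q hQ
      exact ⟨mem_univ _, hQ.2⟩
  refine (realEnvelope_le hu hP ?_).trans_lt h2
  filter_upwards [hc.eventually h3, self_mem_nhdsWithin] with Q hQ hQc
  have := (hL Q.2 hQc.2).dist_le_mul Q.1 (Q.1 + (x - P.1))
  rw [Real.dist_eq, dist_eq_norm] at this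
  have e : Q.1 - (Q.1 + (x - P.1)) = P.1 - x := by abel
  rw [e] at this
  have := (abs_le.1 this).2
  linarith

theorem IsViscositySolution.growth {F : Space n → ℝ → ℝ → Space n → ℝ} {u₀ : Space n → ℝ}
    (hT : 0 < T) (h : IsViscositySolution T F u₀ u) :
    ∃ M : ℝ, 0 < M ∧ ∀ Q ∈ cylinder n T, |u Q.1 Q.2| ≤ M * (1 + ‖Q.1‖) := by
  obtain ⟨K, hK⟩ := h.linear_growth
  refine ⟨max K 1, by positivity, ?_⟩
  have hpos : ∀ x : Space n, ∀ t ∈ Ioo 0 T, |u x t| ≤ max K 1 * (1 + ‖x‖) := fun x t ht =>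
    (hK x t ht).trans (mul_le_mul_of_nonneg_right (le_max_left _ _) (by positivity))
  rintro ⟨x, t⟩ ⟨-, ht0, htT⟩
  rcases eq_or_lt_of_le ht0 with rfl | h0
  swap
  · exact hpos x t ⟨h0, htT⟩
  have hc : Tendsto (fun t : ℝ => (x, t)) (𝓝[Ioo 0 T] 0) (𝓝[cylinder n T] (x, 0)) := by
    refine tendsto_nhdsWithin_iff.2 ⟨?_, ?_⟩
    · exact (Continuous.prodMk_right x).continuousAt.tendsto.mono_left nhdsWithin_le_nhds
    · filter_upwards [self_mem_nhdsWithin] with t ht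
      exact ⟨mem_univ _, ht.1.le, ht.2⟩
  have hlim := ((h.continuous_initial x).tendsto.comp hc).abs
  have : (𝓝[Ioo 0 T] (0 : ℝ)).NeBot := left_nhdsWithin_Ioo_neBot hT
  refine le_of_tendsto hlim ?_
  filter_upwards [self_mem_nhdsWithin] with t ht
  exact hpos x t ht

theorem upperEnvelope_neg (P : Space n × ℝ) :
    upperEnvelope T (fun x t => -u x t) P = -lowerEnvelope T u P := by
  simp only [upperEnvelope, lowerEnvelope, ← EReal.limsup_neg]
  rfl

theorem lowerEnvelope_neg (P : Space n × ℝ) :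
    lowerEnvelope T (fun x t => -u x t) P = -upperEnvelope T u P := by
  simp only [upperEnvelope, lowerEnvelope, ← EReal.liminf_neg]
  rfl

theorem gradient_neg_apply (f : Space n → ℝ) (x : Space n) :
    gradient (fun y => -f y) x = -gradient f x := by
  simp only [gradient, fderiv_fun_neg, map_neg]

/-- Reflection `u ↦ -u` of viscosity solutions. -/
theorem IsViscositySolution.neg {F : Space n → ℝ → ℝ → Space n → ℝ} {u₀ : Space n → ℝ}
    (h : IsViscositySolution T F u₀ u) :
    IsViscositySolution T (fun x t r p => -F x t (-r) (-p)) (fun x => -u₀ x)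
      (fun x t => -u x t) where
  sub := by
    refine ⟨fun P hP => ?_, fun φ hφ x t ht hle heq => ?_⟩
    · rw [upperEnvelope_neg, EReal.neg_lt_comm, EReal.neg_top]
      exact h.super.1 P hP
    · have := h.super.2 (fun P => -φ P) hφ.neg x t ht ?_ ?_
      · rw [gradient_neg_apply, deriv.fun_neg] at this
        linarith
      · filter_upwards [hle] with P hP
        rw [upperEnvelope_neg] at hP
        rw [EReal.coe_neg]
        exact EReal.neg_le_of_neg_le hP
      · rw [upperEnvelope_neg] at heq
        rw [EReal.coe_neg, ← heq, neg_neg]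
  super := by
    refine ⟨fun P hP => ?_, fun φ hφ x t ht hle heq => ?_⟩
    · rw [lowerEnvelope_neg, EReal.lt_neg_comm, EReal.neg_bot]
      exact h.sub.1 P hP
    · have := h.sub.2 (fun P => -φ P) hφ.neg x t ht ?_ ?_
      · rw [gradient_neg_apply, deriv.fun_neg] at this
        linarith
      · filter_upwards [hle] with P hP
        rw [lowerEnvelope_neg] at hP
        rw [EReal.coe_neg]
        exact EReal.le_neg_of_le_neg hP
      · rw [lowerEnvelope_neg] at heq
        rw [EReal.coe_neg, ← heq, neg_neg]
  initial x := by rw [h.initial]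
  continuous_initial x := (h.continuous_initial x).neg
  linear_growth := by simpa only [abs_neg] using h.linear_growth

end

/-! ### Hamiltonian estimates, the initial layer, and jets of the penalization. -/

section

variable {n : ℕ} {T : ℝ}

theorem IsGeometricHamiltonian.map_zero {H₁ : Space n → ℝ → Space n → ℝ}
    (hH : IsGeometricHamiltonian T H₁) (x : Space n) {t : ℝ} (ht : t ∈ Icc 0 T) :
    H₁ x t 0 = 0 := by
  have := hH.homogeneous 2 two_pos x t ht 0
  rw [smul_zero] at this
  linarith

theorem IsGeometricHamiltonian.abs_sub_le {H₁ : Space n → ℝ → Space n → ℝ}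
    (hH : IsGeometricHamiltonian T H₁) : ∃ L₁ : ℝ, 0 < L₁ ∧ ∀ x y : Space n, ∀ t ∈ Icc 0 T,
      ∀ p : Space n, |H₁ x t p - H₁ y t p| ≤ L₁ * ‖x - y‖ * ‖p‖ := by
  obtain ⟨L₁, hL, h⟩ := hH.lipschitz_space
  refine ⟨L₁, hL, fun x y t ht p => ?_⟩
  rcases eq_or_ne p 0 with rfl | hp
  · simp [hH.map_zero _ ht]
  have hp' : 0 < ‖p‖ := norm_pos_iff.2 hp
  have e : p = ‖p‖ • (‖p‖⁻¹ • p) := by rw [smul_smul, mul_inv_cancel₀ hp'.ne', one_smul]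
  have h1 := h x y t ht (‖p‖⁻¹ • p) (by
    rw [norm_smul, norm_inv, norm_norm, inv_mul_cancel₀ hp'.ne'])
  have ex := hH.homogeneous _ hp' x t ht (‖p‖⁻¹ • p)
  have ey := hH.homogeneous _ hp' y t ht (‖p‖⁻¹ • p)
  rw [← e] at ex ey
  rw [ex, ey, ← mul_sub, abs_mul, abs_of_pos hp', mul_comm]
  exact mul_le_mul_of_nonneg_right h1 hp'.le

theorem IsGeometricHamiltonian.exists_time_modulus {H₁ : Space n → ℝ → Space n → ℝ}
    (hH : IsGeometricHamiltonian T H₁) (R B : ℝ) {η : ℝ} (hη : 0 < η) :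
    ∃ τ > 0, ∀ y p : Space n, ‖y‖ ≤ R → ‖p‖ ≤ B → ∀ t ∈ Icc 0 T, ∀ s ∈ Icc 0 T,
      |t - s| < τ → |H₁ y t p - H₁ y s p| < η := by
  have hcomp : IsCompact ((Metric.closedBall (0 : Space n) R) ×ˢ
      (Icc 0 T ×ˢ Metric.closedBall (0 : Space n) B)) :=
    (isCompact_closedBall _ _).prod (isCompact_Icc.prod (isCompact_closedBall _ _))
  have huc := hcomp.uniformContinuousOn_of_continuous (hH.continuousOn.mono (by
    rintro ⟨y, t, p⟩ ⟨-, ht, -⟩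
    exact ⟨mem_univ _, ht, mem_univ _⟩))
  obtain ⟨τ, hτ, h⟩ := Metric.uniformContinuousOn_iff.1 huc η hη
  refine ⟨τ, hτ, fun y p hy hp t ht s hs hts => ?_⟩
  have := h (y, t, p) ⟨by simpa using hy, ht, by simpa using hp⟩ (y, s, p)
    ⟨by simpa using hy, hs, by simpa using hp⟩ (by
      simpa [Prod.dist_eq, Real.dist_eq, hτ] using hts)
  simpa [Real.dist_eq] using this

/-- The compact part `{|x| ≤ R} × [0, S]` of space-time. -/
def compactCylinder (n : ℕ) (R S : ℝ) : Set (Space n × ℝ) :=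
  Metric.closedBall 0 R ×ˢ Icc 0 S

theorem isCompact_compactCylinder (R S : ℝ) : IsCompact (compactCylinder n R S) :=
  (isCompact_closedBall _ _).prod isCompact_Icc

theorem compactCylinder_subset {R S : ℝ} (hS : S < T) :
    compactCylinder n R S ⊆ cylinder n T := by
  rintro ⟨x, t⟩ ⟨-, h0, h1⟩
  exact ⟨mem_univ _, h0, h1.trans_lt hS⟩

theorem upperSemicontinuousOn_sub {V Z : Space n × ℝ → ℝ}
    (hV : UpperSemicontinuousOn V (cylinder n T)) (hZ : LowerSemicontinuousOn Z (cylinder n T))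
    {R S : ℝ} (hS : S < T) :
    UpperSemicontinuousOn (fun q : (Space n × ℝ) × (Space n × ℝ) => V q.1 + -Z q.2)
      (compactCylinder n R S ×ˢ compactCylinder n R S) := by
  have hZ' : UpperSemicontinuousOn (fun Q => -Z Q) (cylinder n T) :=
    continuous_neg.comp_lowerSemicontinuousOn_antitone hZ fun a b h => neg_le_neg h
  refine UpperSemicontinuousOn.add ?_ ?_
  · exact hV.comp continuousOn_fst fun q hq => compactCylinder_subset hS hq.1
  · exact hZ'.comp continuousOn_snd fun q hq => compactCylinder_subset hS hq.2

/-- On the compact set `{V - Z ≥ m}` the quantity `‖x - y‖ + t + s` attains its minimum. A zero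
minimum would contradict the ordering of the data at a single point. -/
theorem exists_initial_layer {V Z : Space n × ℝ → ℝ}
    (hV : UpperSemicontinuousOn V (cylinder n T)) (hZ : LowerSemicontinuousOn Z (cylinder n T))
    (hinit : ∀ x, V (x, 0) ≤ Z (x, 0)) {R S m : ℝ} (hS : S < T) (hm : 0 < m) :
    ∃ r > 0, ∀ P ∈ compactCylinder n R S, ∀ Q ∈ compactCylinder n R S,
      ‖P.1 - Q.1‖ + P.2 + Q.2 < r → V P - Z Q < m := by
  set A := (compactCylinder n R S ×ˢ compactCylinder n R S) ∩
    (fun q : (Space n × ℝ) × (Space n × ℝ) => V q.1 + -Z q.2) ⁻¹' Ici m with hA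
  have hAc : IsCompact A := (upperSemicontinuousOn_sub hV hZ hS).isCompact_inter_preimage_Ici
    ((isCompact_compactCylinder R S).prod (isCompact_compactCylinder R S)) m
  rcases A.eq_empty_or_nonempty with he | hne
  · refine ⟨1, one_pos, fun P hP Q hQ _ => ?_⟩
    by_contra! h
    have : (P, Q) ∈ A := ⟨⟨hP, hQ⟩, by simpa [← sub_eq_add_neg] using h⟩
    rw [he] at this
    exact this
  have hd : Continuous fun q : (Space n × ℝ) × (Space n × ℝ) =>
    ‖q.1.1 - q.2.1‖ + q.1.2 + q.2.2 := by fun_prop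
  obtain ⟨⟨P₀, Q₀⟩, hq, hmin⟩ := hAc.exists_isMinOn hne hd.continuousOn
  refine ⟨‖P₀.1 - Q₀.1‖ + P₀.2 + Q₀.2, ?_, fun P hP Q hQ hlt => ?_⟩
  · obtain ⟨⟨⟨-, h1, -⟩, -, h2, -⟩, h3⟩ := hq
    have hn := norm_nonneg (P₀.1 - Q₀.1)
    change 0 ≤ P₀.2 at h1
    change 0 ≤ Q₀.2 at h2
    by_contra! hle
    have e1 : P₀.2 = 0 := by linarith
    have e2 : Q₀.2 = 0 := by linarith
    have e3 : P₀.1 = Q₀.1 := sub_eq_zero.1 (norm_eq_zero.1 (by linarith))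
    have e4 : P₀ = (P₀.1, 0) := by rw [← e1]
    have e5 : Q₀ = (P₀.1, 0) := by rw [← e2, e3]
    have h3' : m ≤ V P₀ + -Z Q₀ := h3
    have : V P₀ ≤ Z Q₀ := by
      calc V P₀ = V (P₀.1, 0) := congrArg V e4
        _ ≤ Z (P₀.1, 0) := hinit _
        _ = Z Q₀ := congrArg Z e5.symm
    linarith
  · by_contra! h
    have : (P, Q) ∈ A := ⟨⟨hP, hQ⟩, by simpa [← sub_eq_add_neg] using h⟩
    have h0 := isMinOn_iff.1 hmin _ this
    exact absurd hlt (not_lt.2 h0)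

theorem hasGradientAt_mul_norm_sub_sq (c : ℝ) (x y : Space n) :
    HasGradientAt (fun x => c * ‖x - y‖ ^ 2) ((2 * c) • (x - y)) x := by
  rw [hasGradientAt_iff_hasFDerivAt]
  refine (((hasFDerivAt_id x).sub_const y).norm_sq.const_mul c).congr_fderiv ?_
  ext v
  simp
  ring

theorem HasGradientAt.fun_add {f g : Space n → ℝ} {p q x : Space n} (hf : HasGradientAt f p x)
    (hg : HasGradientAt g q x) : HasGradientAt (fun y => f y + g y) (p + q) x := by
  rw [hasGradientAt_iff_hasFDerivAt] at *
  rw [map_add]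
  exact hf.add hg

theorem HasGradientAt.fun_add_const {f : Space n → ℝ} {p x : Space n} (hf : HasGradientAt f p x)
    (c : ℝ) : HasGradientAt (fun y => f y + c) p x := by
  rw [hasGradientAt_iff_hasFDerivAt] at *
  exact hf.add_const c

theorem hasDerivAt_div_sub {κ t : ℝ} (ht : t < T) :
    HasDerivAt (fun s => κ / (T - s)) (κ / (T - t) ^ 2) t := by
  have h := ((hasDerivAt_id t).const_sub T).inv (by simpa using (sub_pos.2 ht).ne')
  refine (h.const_mul κ).congr_deriv ?_
  simp [div_eq_mul_inv]

/-- The superjet read off from the doubled penalization in its first pair of variables. -/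
theorem hasSuperjet_of_isLocalMax {V : Space n × ℝ → ℝ} {P : Space n × ℝ} (hP : P.2 < T)
    {A B L₁ L₂ α κ s : ℝ} {y : Space n}
    (h : IsLocalMax (fun Q : Space n × ℝ => V Q - (A * Real.exp (2 * L₁ * Q.2) * ‖Q.1 - y‖ ^ 2
      + B * (Q.2 - s) ^ 2 + α * Real.exp (L₂ * Q.2) * (1 + ‖Q.1‖ ^ 2) + κ / (T - Q.2))) P) :
    HasSuperjet V P (2 * L₁ * (A * Real.exp (2 * L₁ * P.2) * ‖P.1 - y‖ ^ 2) + 2 * B * (P.2 - s)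
      + L₂ * (α * Real.exp (L₂ * P.2) * (1 + ‖P.1‖ ^ 2)) + κ / (T - P.2) ^ 2)
      ((2 * (A * Real.exp (2 * L₁ * P.2))) • (P.1 - y)
        + (2 * (α * Real.exp (L₂ * P.2))) • P.1) := by
  refine ⟨_, ?_, h, ?_, ?_⟩
  · have hne : T - P.2 ≠ 0 := (sub_pos.2 hP).ne'
    refine ContDiffAt.add ?_ (contDiffAt_const.div (by fun_prop) hne)
    have h1 : ContDiff ℝ 1 fun Q : Space n × ℝ => ‖Q.1 - y‖ ^ 2 :=
      (contDiff_fst.sub contDiff_const).norm_sq ℝ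
    have h2 : ContDiff ℝ 1 fun Q : Space n × ℝ => ‖Q.1‖ ^ 2 := contDiff_fst.norm_sq ℝ
    have : ContDiff ℝ 1 (fun Q : Space n × ℝ => A * Real.exp (2 * L₁ * Q.2) * ‖Q.1 - y‖ ^ 2
      + B * (Q.2 - s) ^ 2 + α * Real.exp (L₂ * Q.2) * (1 + ‖Q.1‖ ^ 2)) := by fun_prop
    exact this.contDiffAt
  · have d1 := ((((hasDerivAt_id P.2).const_mul (2 * L₁)).exp.const_mul A).mul_const
      (‖P.1 - y‖ ^ 2))
    have d2 := ((((hasDerivAt_id P.2).sub_const s).pow 2).const_mul B)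
    have d3 := ((((hasDerivAt_id P.2).const_mul L₂).exp.const_mul α).mul_const (1 + ‖P.1‖ ^ 2))
    refine (((d1.add d2).add d3).add (hasDerivAt_div_sub hP)).congr_deriv ?_
    simp
    ring
  · have g1 := hasGradientAt_mul_norm_sub_sq (A * Real.exp (2 * L₁ * P.2)) P.1 y
    have g2 := hasGradientAt_mul_norm_sub_sq (α * Real.exp (L₂ * P.2)) P.1 0
    simp only [sub_zero] at g2
    have g3 := HasGradientAt.fun_add_const (HasGradientAt.fun_add g1 g2)
      (B * (P.2 - s) ^ 2 + α * Real.exp (L₂ * P.2) + κ / (T - P.2))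
    convert g3 using 2
    ring

/-- The subjet read off from the doubled penalization in its second pair of variables. -/
theorem hasSubjet_of_isLocalMax {Z : Space n × ℝ → ℝ} {Q : Space n × ℝ} (hQ : Q.2 < T)
    {A B κ t : ℝ} {x : Space n}
    (h : IsLocalMax (fun P : Space n × ℝ => -Z P - (A * ‖x - P.1‖ ^ 2
      + B * (t - P.2) ^ 2 + κ / (T - P.2))) Q) :
    HasSubjet Z Q (2 * B * (t - Q.2) - κ / (T - Q.2) ^ 2) ((2 * A) • (x - Q.1)) := by
  refine ⟨_, ?_, h, ?_, ?_⟩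
  · have hne : T - Q.2 ≠ 0 := (sub_pos.2 hQ).ne'
    refine ContDiffAt.add ?_ (contDiffAt_const.div (by fun_prop) hne)
    have h1 : ContDiff ℝ 1 fun P : Space n × ℝ => ‖x - P.1‖ ^ 2 :=
      (contDiff_const.sub contDiff_fst).norm_sq ℝ
    have : ContDiff ℝ 1 (fun P : Space n × ℝ => A * ‖x - P.1‖ ^ 2 + B * (t - P.2) ^ 2) := by
      fun_prop
    exact this.contDiffAt
  · have d2 := ((((hasDerivAt_id Q.2).const_sub t).pow 2).const_mul B)
    have d := ((hasDerivAt_const Q.2 (A * ‖x - Q.1‖ ^ 2)).add d2).add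
      (hasDerivAt_div_sub (κ := κ) hQ)
    refine d.congr_deriv ?_
    simp
    ring
  · have g1 := hasGradientAt_mul_norm_sub_sq A Q.1 x
    have g3 := HasGradientAt.fun_add_const g1 (B * (t - Q.2) ^ 2 + κ / (T - Q.2))
    rw [← smul_neg, neg_sub]
    convert g3 using 2
    rw [norm_sub_rev]
    ring

end

/-! ### Comparison principle by doubling of variables. -/

section

variable {n : ℕ} {T : ℝ}

/-- The inequality obtained by subtracting the viscosity inequalities at a maximum point of the
doubled function is contradictory. -/
theorem false_of_doubled_inequalities {H₁ : Space n → ℝ → Space n → ℝ} {L₁ L₂ K A E α' κ a v z : ℝ}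
    {x y p g : Space n} {t s : ℝ} (hκ : 0 < κ) (hK : 0 ≤ K)
    (ht : t ∈ Ioo 0 T) (hs : s < T)
    (hE : 0 ≤ A * E) (hL₂ : 0 < L₂) (hα' : 0 ≤ α') (hp : p = (2 * (A * E)) • (x - y))
    (hg : g = (2 * α') • x)
    (h1 : |H₁ x t p - H₁ y t p| ≤ L₁ * ‖x - y‖ * ‖p‖)
    (h2 : |H₁ x t (p + g) - H₁ x t p| ≤ L₂ * ‖p + g - p‖)
    (h3 : |H₁ y t p - H₁ y s p| < κ / T ^ 2)
    (hsub : 2 * L₁ * (A * E * ‖x - y‖ ^ 2) + a + L₂ * (α' * (1 + ‖x‖ ^ 2)) + κ / (T - t) ^ 2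
      ≤ H₁ x t (p + g) - K * v)
    (hsup : H₁ y s p - K * z ≤ a - κ / (T - s) ^ 2) (hvz : z ≤ v) : False := by
  have e1 : ‖p‖ = 2 * (A * E) * ‖x - y‖ := by
    rw [hp, norm_smul, Real.norm_of_nonneg (by linarith)]
  have e2 : ‖p + g - p‖ = 2 * α' * ‖x‖ := by
    rw [add_sub_cancel_left, hg, norm_smul, Real.norm_of_nonneg (by linarith)]
  rw [e1] at h1
  rw [e2] at h2
  have h4 : L₂ * (2 * α' * ‖x‖) ≤ L₂ * (α' * (1 + ‖x‖ ^ 2)) := by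
    refine mul_le_mul_of_nonneg_left ?_ hL₂.le
    nlinarith [mul_nonneg hα' (sq_nonneg (1 - ‖x‖))]
  have h5 : κ / T ^ 2 ≤ κ / (T - t) ^ 2 := by
    have h0 : 0 < T - t := sub_pos.2 ht.2
    have : T - t ≤ T := by linarith [ht.1]
    gcongr
  have h6 : 0 < κ / (T - s) ^ 2 := div_pos hκ (pow_pos (sub_pos.2 hs) 2)
  have h7 : K * z ≤ K * v := mul_le_mul_of_nonneg_left hvz hK
  have h8 := (abs_le.1 h1).2
  have h9 := (abs_le.1 h2).2
  have h10 := (abs_lt.1 h3).2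
  -- In the difference of the two inequalities, the exponential weights absorb the errors from `x ≠
  -- y` and from `g`, while `κ / T ^ 2` absorbs the error from `t ≠ s`; the term `a` cancels.
  nlinarith

theorem norm_le_of_sq_growth {α M r : ℝ} (hα : 0 < α) (hM : 0 < M) (hr : 0 ≤ r)
    (h : α * (1 + r ^ 2) ≤ M * (1 + r)) : r ≤ 1 + 2 * M / α := by
  by_contra! hlt
  have h0 : 0 < 2 * M / α := by positivity
  have h1 : 1 < r := by linarith
  have h2 : 2 * M < α * r := by
    have : 2 * M / α < r := by linarith
    rw [div_lt_iff₀ hα] at this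
    linarith
  nlinarith

/-- Bounds the gradient of the penalty at infinity independently of `α`; this is the source of `4 *
M` in the `Good` condition. -/
theorem two_mul_le_of_sq_growth {α M r : ℝ} (hα : 0 < α) (hM : 0 < M) (hr : 0 ≤ r)
    (h : α * (1 + r ^ 2) ≤ M * (1 + r)) : 2 * α * r ≤ 4 * M := by
  rcases le_total r 1 with h1 | h1
  · nlinarith
  · by_contra! hlt
    nlinarith

theorem lt_sub_of_div_lt {κ D t : ℝ} (hκ : 0 < κ) (hD : 0 < D) (ht : t < T)
    (h : κ / (T - t) < D) : t < T - κ / (2 * D) := by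
  have h0 : 0 < T - t := sub_pos.2 ht
  rw [div_lt_iff₀ h0] at h
  rw [lt_sub_comm, div_lt_iff₀ (by positivity)]
  linarith

theorem sq_mul_le_of_mul_sq_le {D r s C : ℝ} (hD : 0 < D) (hr : 0 < r)
    (h : C * D / r ^ 2 * s ^ 2 ≤ D) : |s| ^ 2 * C ≤ r ^ 2 := by
  rw [div_mul_eq_mul_div, div_le_iff₀ (by positivity)] at h
  rw [sq_abs]
  refine le_of_mul_le_mul_left ?_ hD
  linarith

set_option maxHeartbeats 1000000 in
/-- Comparison up to the penalization, by doubling the variables. -/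
theorem sub_le_penalty {H₁ : Space n → ℝ → Space n → ℝ} (hT : 0 < T)
    (hH : IsGeometricHamiltonian T H₁) {V Z : Space n × ℝ → ℝ} {Good : Space n → Prop} {K M : ℝ}
    (hK : 0 ≤ K) (hM : 0 < M)
    (hV : UpperSemicontinuousOn V (cylinder n T)) (hZ : LowerSemicontinuousOn Z (cylinder n T))
    (hVM : ∀ P ∈ cylinder n T, V P ≤ M * (1 + ‖P.1‖)) (hZ0 : ∀ P ∈ cylinder n T, 0 < Z P)
    (hinit : ∀ x, V (x, 0) ≤ Z (x, 0))
    (hsub : ∀ P : Space n × ℝ, P.2 ∈ Ioo 0 T → 0 < V P → ∀ a p, HasSuperjet V P a p →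
      a ≤ H₁ P.1 P.2 p - K * V P ∧ ∀ e, ‖e‖ ≤ 4 * M → Good (p - e))
    (hsuper : ∀ P : Space n × ℝ, P.2 ∈ Ioo 0 T → ∀ a p, HasSubjet Z P a p → Good p →
      H₁ P.1 P.2 p - K * Z P ≤ a)
    {L₂ : ℝ} (hL₂ : 0 < L₂) (hlip : ∀ x : Space n, ∀ t ∈ Icc 0 T, ∀ p q : Space n,
      |H₁ x t p - H₁ x t q| ≤ L₂ * ‖p - q‖)
    {α κ : ℝ} (hα : 0 < α) (hκ : 0 < κ) {P₀ : Space n × ℝ} (hP₀ : P₀ ∈ cylinder n T) :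
    V P₀ - Z P₀ ≤ α * Real.exp (L₂ * P₀.2) * (1 + ‖P₀.1‖ ^ 2) + 2 * (κ / (T - P₀.2)) := by
  by_contra! hcon
  obtain ⟨L₁, hL₁, hlip₁⟩ := hH.abs_sub_le
  set m := V P₀ - Z P₀ - (α * Real.exp (L₂ * P₀.2) * (1 + ‖P₀.1‖ ^ 2) + 2 * (κ / (T - P₀.2)))
    with hm_def
  have hm : 0 < m := by rw [hm_def]; linarith
  -- All parameters are fixed in advance and no limit is taken: `α` and `κ` determine `R₀`, `D`,
  -- `S`, then the initial layer gives `r`, which gives `A`, then `τ`, and finally `B`.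
  set R₀ := 1 + 2 * M / α with hR₀
  have hR₀1 : 1 ≤ R₀ := by rw [hR₀]; linarith [show 0 < 2 * M / α by positivity]
  set D := M * (1 + R₀) with hD_def
  have hD : 0 < D := by rw [hD_def]; positivity
  set S := T - κ / (2 * D) with hS_def
  have hST : S < T := by rw [hS_def]; linarith [show 0 < κ / (2 * D) by positivity]
  obtain ⟨r', hr', hlayer⟩ := exists_initial_layer hV hZ hinit (R := R₀ + 2) hST hm
  set r := min r' 1 with hr_def
  have hr : 0 < r := lt_min hr' one_pos
  -- `D` bounds `V` on the relevant ball, so `A ‖x - y‖² ≤ D`; the factor `10` exceeds `9`, which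
  -- yields `‖x - y‖ < r / 3`.
  set A := 10 * D / r ^ 2 with hA_def
  have hA : 0 < A := by rw [hA_def]; positivity
  obtain ⟨τ, hτ, hmod⟩ := hH.exists_time_modulus (R₀ + 2)
    (2 * (A * Real.exp (2 * L₁ * T)) * 1) (η := κ / T ^ 2) (by positivity)
  set τ' := min τ (r / 3) with hτ'_def
  have hτ' : 0 < τ' := lt_min hτ (by positivity)
  set B := 2 * D / τ' ^ 2 with hB_def
  have hB : 0 < B := by rw [hB_def]; positivity
  set pen : Space n × ℝ → Space n × ℝ → ℝ := fun P Q =>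
    A * Real.exp (2 * L₁ * P.2) * ‖P.1 - Q.1‖ ^ 2 + B * (P.2 - Q.2) ^ 2
      + α * Real.exp (L₂ * P.2) * (1 + ‖P.1‖ ^ 2) + κ / (T - P.2) + κ / (T - Q.2) with hpen
  have bound : ∀ P ∈ cylinder n T, ∀ Q ∈ cylinder n T, m ≤ V P - Z Q - pen P Q →
      ‖P.1‖ ≤ R₀ ∧ P.2 < S ∧ Q.2 < S ∧ ‖P.1 - Q.1‖ < r / 3 ∧ |P.2 - Q.2| < τ' ∧
        α * Real.exp (L₂ * P.2) * (1 + ‖P.1‖ ^ 2) ≤ V P ∧ Z Q ≤ V P ∧ m ≤ V P - Z Q := by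
    intro P hP Q hQ hPQ
    have hP0 : 0 ≤ P.2 := hP.2.1
    have i1 : 0 ≤ A * Real.exp (2 * L₁ * P.2) * ‖P.1 - Q.1‖ ^ 2 := by positivity
    have i2 : 0 ≤ B * (P.2 - Q.2) ^ 2 := by positivity
    have i3 : 0 ≤ α * Real.exp (L₂ * P.2) * (1 + ‖P.1‖ ^ 2) := by positivity
    have i4 : 0 < κ / (T - P.2) := div_pos hκ (sub_pos.2 hP.2.2)
    have i5 : 0 < κ / (T - Q.2) := div_pos hκ (sub_pos.2 hQ.2.2)
    have hz := hZ0 Q hQ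
    have hv := hVM P hP
    simp only [hpen] at hPQ
    have hexp : 1 ≤ Real.exp (L₂ * P.2) := Real.one_le_exp (by positivity)
    have hexp₁ : 1 ≤ Real.exp (2 * L₁ * P.2) := Real.one_le_exp (by positivity)
    have j1 : α * (1 + ‖P.1‖ ^ 2) ≤ α * Real.exp (L₂ * P.2) * (1 + ‖P.1‖ ^ 2) := by
      refine mul_le_mul_of_nonneg_right ?_ (by positivity)
      exact le_mul_of_one_le_right hα.le hexp
    have hx : ‖P.1‖ ≤ R₀ := norm_le_of_sq_growth hα hM (norm_nonneg _) (by linarith)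
    have hVD : V P ≤ D := hv.trans (by rw [hD_def]; gcongr)
    refine ⟨hx, lt_sub_of_div_lt hκ hD hP.2.2 (by linarith),
      lt_sub_of_div_lt hκ hD hQ.2.2 (by linarith), ?_, ?_, by linarith,
      by linarith, by linarith⟩
    · refine lt_of_pow_lt_pow_left₀ 2 (by positivity) ?_
      have k1 : A * ‖P.1 - Q.1‖ ^ 2 ≤ D := by
        have : A * ‖P.1 - Q.1‖ ^ 2 ≤ A * Real.exp (2 * L₁ * P.2) * ‖P.1 - Q.1‖ ^ 2 := by
          refine mul_le_mul_of_nonneg_right ?_ (by positivity)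
          exact le_mul_of_one_le_right hA.le hexp₁
        linarith
      have k2 := sq_mul_le_of_mul_sq_le hD hr k1
      rw [abs_norm] at k2
      have k3 : 0 < r ^ 2 := by positivity
      rw [div_pow]
      linarith
    · refine abs_lt_of_sq_lt_sq ?_ hτ'.le
      have k1 : B * (P.2 - Q.2) ^ 2 ≤ D := by linarith
      have k2 := sq_mul_le_of_mul_sq_le hD hτ' k1
      have k3 : 0 < τ' ^ 2 := by positivity
      rw [sq_abs] at k2
      linarith
  have hbase : m ≤ V P₀ - Z P₀ - pen P₀ P₀ := by
    simp only [hpen, hm_def, sub_self, norm_zero]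
    apply le_of_eq
    ring
  obtain ⟨b1, b2, -⟩ := bound P₀ hP₀ P₀ hP₀ hbase
  have hmem : P₀ ∈ compactCylinder n (R₀ + 2) S :=
    ⟨by simpa using b1.trans (by linarith), hP₀.2.1, b2.le⟩
  have hpenc : ContinuousOn (fun q : (Space n × ℝ) × (Space n × ℝ) => -pen q.1 q.2)
      (compactCylinder n (R₀ + 2) S ×ˢ compactCylinder n (R₀ + 2) S) := by
    have e1 : ∀ q ∈ compactCylinder n (R₀ + 2) S ×ˢ compactCylinder n (R₀ + 2) S,
        T - q.1.2 ≠ 0 := fun q hq => (sub_pos.2 (compactCylinder_subset hST hq.1).2.2).ne'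
    have e2 : ∀ q ∈ compactCylinder n (R₀ + 2) S ×ˢ compactCylinder n (R₀ + 2) S,
        T - q.2.2 ≠ 0 := fun q hq => (sub_pos.2 (compactCylinder_subset hST hq.2).2.2).ne'
    have c1 : ContinuousOn (fun q : (Space n × ℝ) × (Space n × ℝ) => κ / (T - q.1.2))
      (compactCylinder n (R₀ + 2) S ×ˢ compactCylinder n (R₀ + 2) S) :=
      ContinuousOn.div (by fun_prop) (by fun_prop) e1
    have c2 : ContinuousOn (fun q : (Space n × ℝ) × (Space n × ℝ) => κ / (T - q.2.2))
      (compactCylinder n (R₀ + 2) S ×ˢ compactCylinder n (R₀ + 2) S) :=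
      ContinuousOn.div (by fun_prop) (by fun_prop) e2
    refine ContinuousOn.neg (ContinuousOn.add (ContinuousOn.add ?_ c1) c2)
    exact Continuous.continuousOn (by fun_prop)
  obtain ⟨⟨P, Q⟩, ⟨hP, hQ⟩, hmax⟩ := UpperSemicontinuousOn.exists_isMaxOn
    (Set.Nonempty.prod ⟨P₀, hmem⟩ ⟨P₀, hmem⟩) ((isCompact_compactCylinder _ _).prod (isCompact_compactCylinder _ _))
    ((upperSemicontinuousOn_sub hV hZ (R := R₀ + 2) hST).add hpenc.upperSemicontinuousOn)
  have hPc := compactCylinder_subset hST hP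
  have hQc := compactCylinder_subset hST hQ
  have hmax' : ∀ P' ∈ compactCylinder n (R₀ + 2) S, ∀ Q' ∈ compactCylinder n (R₀ + 2) S,
      V P' - Z Q' - pen P' Q' ≤ V P - Z Q - pen P Q := by
    intro P' hP' Q' hQ'
    have := isMaxOn_iff.1 hmax (P', Q') ⟨hP', hQ'⟩
    simp only at this
    linarith
  obtain ⟨c1, c2, c3, c4, c5, c6, c7, c8⟩ := bound P hPc Q hQc
    (hbase.trans (hmax' _ hmem _ hmem))
  have hr1 : r ≤ 1 := min_le_right _ _
  have hτr : τ' ≤ r / 3 := min_le_right _ _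
  have hP0 : 0 ≤ P.2 := hPc.2.1
  have hQ0 : 0 ≤ Q.2 := hQc.2.1
  have c5' := abs_lt.1 c5
  -- The maximum lies outside the initial layer. As `‖P.1 - Q.1‖` and `|P.2 - Q.2|` are below `r /
  -- 3`, neither time can vanish.
  have hlarge : r ≤ ‖P.1 - Q.1‖ + P.2 + Q.2 := by
    by_contra! hlt
    exact absurd (hlayer P hP Q hQ (hlt.trans_le (min_le_left _ _))) (not_lt.2 c8)
  have hPpos : 0 < P.2 := by linarith
  have hQpos : 0 < Q.2 := by linarith
  have hQn : ‖Q.1‖ ≤ R₀ + 1 := by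
    have := norm_sub_norm_le Q.1 P.1
    rw [norm_sub_rev] at this
    linarith
  have hnhds : ∀ P' : Space n × ℝ, ‖P'.1‖ < R₀ + 2 → 0 < P'.2 → P'.2 < S →
      ∀ᶠ Q' in 𝓝 P', Q' ∈ compactCylinder n (R₀ + 2) S := by
    intro P' h1 h2 h3
    have o1 : ∀ᶠ Q' : Space n × ℝ in 𝓝 P', ‖Q'.1‖ < R₀ + 2 :=
      (continuous_fst.norm).continuousAt.eventually (gt_mem_nhds h1)
    have o2 : ∀ᶠ Q' : Space n × ℝ in 𝓝 P', Q'.2 ∈ Ioo 0 S :=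
      continuous_snd.continuousAt.eventually (isOpen_Ioo.mem_nhds ⟨h2, h3⟩)
    filter_upwards [o1, o2] with Q' q1 q2
    exact ⟨by simpa using q1.le, q2.1.le, q2.2.le⟩
  have jV := hasSuperjet_of_isLocalMax (V := V) (P := P) hPc.2.2 (A := A) (B := B) (L₁ := L₁)
    (L₂ := L₂) (α := α) (κ := κ) (s := Q.2) (y := Q.1) (by
      filter_upwards [hnhds P (by linarith) hPpos c2] with P' hP'
      have := hmax' P' hP' Q hQ
      simp only [hpen] at this
      linarith)
  have jZ := hasSubjet_of_isLocalMax (Z := Z) (Q := Q) hQc.2.2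
    (A := A * Real.exp (2 * L₁ * P.2)) (B := B) (κ := κ) (t := P.2) (x := P.1) (by
      filter_upwards [hnhds Q (by linarith) hQpos c3] with Q' hQ'
      have := hmax' P hP Q' hQ'
      simp only [hpen] at this
      linarith)
  have hα'pos : 0 < α * Real.exp (L₂ * P.2) := by positivity
  have hAE : 0 ≤ A * Real.exp (2 * L₁ * P.2) := by positivity
  have hVpos : 0 < V P := (hZ0 Q hQc).trans_le c7
  obtain ⟨s1, s2⟩ := hsub P ⟨hPpos, hPc.2.2⟩ hVpos _ _ jV
  have hgood := s2 ((2 * (α * Real.exp (L₂ * P.2))) • P.1) (by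
    rw [norm_smul, Real.norm_of_nonneg (by positivity)]
    exact two_mul_le_of_sq_growth hα'pos hM (norm_nonneg _) (c6.trans (hVM P hPc)))
  rw [add_sub_cancel_right] at hgood
  have s3 := hsuper Q ⟨hQpos, hQc.2.2⟩ _ _ jZ hgood
  have hpn : ‖(2 * (A * Real.exp (2 * L₁ * P.2))) • (P.1 - Q.1)‖ ≤
      2 * (A * Real.exp (2 * L₁ * T)) * 1 := by
    rw [norm_smul, Real.norm_of_nonneg (by positivity)]
    have : P.2 ≤ T := hPc.2.2.le
    gcongr
    linarith
  exact false_of_doubled_inequalities hκ hK ⟨hPpos, hPc.2.2⟩ hQc.2.2 hAE hL₂ hα'pos.le rfl rfl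
    (hlip₁ _ _ _ ⟨hP0, hPc.2.2.le⟩ _) (hlip _ _ ⟨hP0, hPc.2.2.le⟩ _ _)
    (hmod Q.1 _ (by linarith) hpn _ ⟨hP0, hPc.2.2.le⟩ _ ⟨hQ0, hQc.2.2.le⟩
      (c5.trans_le (min_le_left _ _))) s1 s3 c7

/-- Comparison principle for the Cauchy problem of a geometric Hamiltonian with linear damping. The
subsolution inequality is only needed where `V > 0`, and the supersolution inequality only
for the gradients in `Good`. -/
theorem le_of_subsolution_of_supersolution {H₁ : Space n → ℝ → Space n → ℝ} (hT : 0 < T)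
    (hH : IsGeometricHamiltonian T H₁) {V Z : Space n × ℝ → ℝ} {Good : Space n → Prop} {K M : ℝ}
    (hK : 0 ≤ K) (hM : 0 < M)
    (hV : UpperSemicontinuousOn V (cylinder n T)) (hZ : LowerSemicontinuousOn Z (cylinder n T))
    (hVM : ∀ P ∈ cylinder n T, V P ≤ M * (1 + ‖P.1‖)) (hZ0 : ∀ P ∈ cylinder n T, 0 < Z P)
    (hinit : ∀ x, V (x, 0) ≤ Z (x, 0))
    (hsub : ∀ P : Space n × ℝ, P.2 ∈ Ioo 0 T → 0 < V P → ∀ a p, HasSuperjet V P a p →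
      a ≤ H₁ P.1 P.2 p - K * V P ∧ ∀ e, ‖e‖ ≤ 4 * M → Good (p - e))
    (hsuper : ∀ P : Space n × ℝ, P.2 ∈ Ioo 0 T → ∀ a p, HasSubjet Z P a p → Good p →
      H₁ P.1 P.2 p - K * Z P ≤ a)
    {P : Space n × ℝ} (hP : P ∈ cylinder n T) : V P ≤ Z P := by
  obtain ⟨L₂, hL₂, hlip⟩ := hH.lipschitz_gradient
  refine le_of_forall_pos_le_add fun ε hε => ?_
  have hTP : 0 < T - P.2 := sub_pos.2 hP.2.2
  set c := Real.exp (L₂ * P.2) * (1 + ‖P.1‖ ^ 2) with hc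
  have hc0 : 0 < c := by positivity
  -- These `α` and `κ` make the penalty at `P` equal to `ε / 2 + 2 * (ε / 4) = ε`.
  have := sub_le_penalty hT hH hK hM hV hZ hVM hZ0 hinit hsub hsuper hL₂ hlip
    (α := ε / 2 / c) (κ := ε / 4 * (T - P.2)) (by positivity) (by positivity) hP
  rw [mul_assoc, ← hc, div_mul_cancel₀ _ hc0.ne', mul_div_cancel_right₀ _ hTP.ne'] at this
  linarith

end

/-! ### The soft positive part and inclusion of positive phases. -/

section

variable {n : ℕ} {T : ℝ}

/-- A smooth increasing bijection of `ℝ` onto `(0, ∞)` above the positive part, at scale `δ`. -/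
noncomputable def softPlus (δ r : ℝ) : ℝ := (r + √(r ^ 2 + 4 * δ ^ 2)) / 2

/-- The inverse of `softPlus δ` on `(0, ∞)`. -/
noncomputable def softPlusInv (δ z : ℝ) : ℝ := z - δ ^ 2 / z

theorem sq_sqrt_softPlus (δ r : ℝ) : √(r ^ 2 + 4 * δ ^ 2) ^ 2 = r ^ 2 + 4 * δ ^ 2 :=
  Real.sq_sqrt (by positivity)

theorem abs_lt_sqrt_softPlus {δ : ℝ} (hδ : 0 < δ) (r : ℝ) : |r| < √(r ^ 2 + 4 * δ ^ 2) := by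
  refine abs_lt_of_sq_lt_sq ?_ (Real.sqrt_nonneg _)
  rw [sq_sqrt_softPlus]
  have : 0 < δ ^ 2 := by positivity
  linarith

theorem softPlus_pos {δ : ℝ} (hδ : 0 < δ) (r : ℝ) : 0 < softPlus δ r := by
  have := (abs_lt.1 (abs_lt_sqrt_softPlus hδ r)).1
  unfold softPlus
  linarith

theorem le_softPlus {δ : ℝ} (hδ : 0 < δ) (r : ℝ) : r ≤ softPlus δ r := by
  have := (abs_lt.1 (abs_lt_sqrt_softPlus hδ r)).2
  unfold softPlus
  linarith

theorem softPlusInv_softPlus {δ : ℝ} (hδ : 0 < δ) (r : ℝ) :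
    softPlusInv δ (softPlus δ r) = r := by
  have h0 := softPlus_pos hδ r
  unfold softPlusInv
  rw [sub_eq_iff_eq_add, ← sub_eq_iff_eq_add', eq_div_iff h0.ne']
  unfold softPlus
  linarith [sq_sqrt_softPlus δ r]

theorem hasDerivAt_softPlusInv (δ : ℝ) {z : ℝ} (hz : 0 < z) :
    HasDerivAt (softPlusInv δ) (1 + δ ^ 2 / z ^ 2) z := by
  refine ((hasDerivAt_id z).sub ((hasDerivAt_inv hz.ne').const_mul (δ ^ 2))).congr_deriv ?_
  simp [div_eq_mul_inv]

theorem contDiffOn_softPlusInv (δ : ℝ) : ContDiffOn ℝ 1 (softPlusInv δ) (Ioi 0) :=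
  contDiffOn_id.sub (contDiffOn_const.div contDiffOn_id fun _ hz => (mem_Ioi.1 hz).ne')

theorem strictMonoOn_softPlusInv (δ : ℝ) : StrictMonoOn (softPlusInv δ) (Ioi 0) := by
  intro a ha b _ hab
  have ha' : 0 < a := ha
  have : δ ^ 2 / b ≤ δ ^ 2 / a := by gcongr
  unfold softPlusInv
  linarith

/-- The factor `1 + δ² / z²` is the derivative of `softPlusInv δ`. This lets a perturbation of size
`|r|` become damping linear in `softPlus δ r` after division by that derivative. -/
theorem abs_softPlusInv_le (δ : ℝ) {z : ℝ} (hz : 0 < z) :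
    |softPlusInv δ z| ≤ (1 + δ ^ 2 / z ^ 2) * z := by
  have e : (1 + δ ^ 2 / z ^ 2) * z = z + δ ^ 2 / z := by field_simp
  have : 0 ≤ δ ^ 2 / z := by positivity
  rw [e]
  unfold softPlusInv
  exact abs_le.2 ⟨by linarith, by linarith⟩

theorem monotone_softPlus {δ : ℝ} (hδ : 0 < δ) : Monotone (softPlus δ) := by
  intro r s h
  rw [← (strictMonoOn_softPlusInv δ).le_iff_le (softPlus_pos hδ r) (softPlus_pos hδ s),
    softPlusInv_softPlus hδ, softPlusInv_softPlus hδ]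
  exact h

theorem softPlus_zero {δ : ℝ} (hδ : 0 < δ) : softPlus δ 0 = δ := by
  have : √(0 ^ 2 + 4 * δ ^ 2) = 2 * δ := by
    rw [show 0 ^ 2 + 4 * δ ^ 2 = (2 * δ) ^ 2 by ring]
    exact Real.sqrt_sq (by linarith)
  unfold softPlus
  rw [this]
  ring

theorem continuous_softPlus (δ : ℝ) : Continuous (softPlus δ) := by
  unfold softPlus
  fun_prop

/-- If `v` is a subsolution and `z` a supersolution, with the same datum, of the geometric equation
perturbed by terms of linear size, then the positivity set of `v` is contained in that of `z`.
Where `z ≥ 0` the lower bound on the perturbation is only needed for gradients in `Small`. -/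
theorem pos_of_pos {H₁ : Space n → ℝ → Space n → ℝ} (hT : 0 < T)
    (hH : IsGeometricHamiltonian T H₁) {Fv Fz : Space n → ℝ → ℝ → Space n → ℝ}
    {u₀ : Space n → ℝ} {v z : Space n → ℝ → ℝ} (hv : IsViscositySolution T Fv u₀ v)
    (hz : IsViscositySolution T Fz u₀ z) {Kv Kz : ℝ} (hKv : 0 ≤ Kv) (hKz : 0 ≤ Kz)
    {Small : Space n → Prop}
    (hFv : ∀ x t r p, 0 < r → Fv x t r p ≤ H₁ x t p + Kv * r)
    (hFz : ∀ x t r p, (0 ≤ r → Small p) → H₁ x t p - Kz * |r| ≤ Fz x t r p)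
    (hcase : (∀ p, Small p) ∨ ((∃ ρ : ℝ, 0 < ρ ∧ ∀ p, ‖p‖ ≤ ρ → Small p) ∧
      ∃ L : ℝ≥0, ∀ t ∈ Ico 0 T, LipschitzWith L (fun x => v x t)))
    {x : Space n} {t : ℝ} (ht : t ∈ Ioo 0 T) (hpos : 0 < v x t) : 0 < z x t := by
  obtain ⟨M, hM, hvM⟩ := hv.growth hT
  obtain ⟨M', -, hzM⟩ := hz.neg.growth hT
  set U := realEnvelope T v with hU
  set Y := realEnvelope T (fun x t => -z x t) with hY
  -- `Kv` cancels the growth of `v`, and `Kz` supplies the damping matching that of `Z`.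
  set K := Kv + Kz with hK
  have hK0 : 0 ≤ K := add_nonneg hKv hKz
  -- If `p` is a gradient of `Z`, the matching one of `z_*` is `d • p` with `d = 1 + δ² / Z²`. Where
  -- `z_* ≥ 0`, `Z ≥ δ` and so `1 ≤ d ≤ 2`.
  set Good : Space n → Prop := fun p => ∀ c : ℝ, 1 ≤ c → c ≤ 2 → Small (c • p) with hGood
  have hexp : ∀ s : ℝ, 0 ≤ s → Real.exp (-K * s) ≤ 1 := fun s hs => by
    rw [Real.exp_le_one_iff]
    nlinarith
  obtain ⟨η, hη0, hη1, hη⟩ : ∃ η : ℝ, 0 < η ∧ η ≤ 1 ∧ ∀ P : Space n × ℝ, P.2 ∈ Ioo 0 T →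
      ∀ a p, HasSuperjet (fun Q => η * Real.exp (-K * Q.2) * U Q) P a p →
        ∀ e, ‖e‖ ≤ 4 * (η * M) → Good (p - e) := by
    rcases hcase with hall | ⟨⟨ρ, hρ, hsmall⟩, L, hL⟩
    · exact ⟨1, one_pos, le_rfl, fun _ _ _ _ _ _ _ _ _ _ => hall _⟩
    have hden : 0 < 2 * (L + 4 * M) := by positivity
    -- The gradient of `V` is at most `η L`, the penalty adds at most `4 η M`, and the factor `2`
    -- allows for the dilation in `Good`.
    refine ⟨min 1 (ρ / (2 * (L + 4 * M))), by positivity, min_le_left _ _, ?_⟩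
    set η := min 1 (ρ / (2 * (L + 4 * M))) with hη_def
    have hη0 : 0 < η := by positivity
    have hηρ : η * (2 * (L + 4 * M)) ≤ ρ := (le_div_iff₀ hden).1 (min_le_right _ _)
    intro P hP a p hj e he c hc1 hc2
    refine hsmall _ ?_
    have hPc : P ∈ cylinder n T := ⟨mem_univ _, hP.1.le, hP.2⟩
    have hpL : ‖p‖ ≤ η * L := by
      refine hj.norm_le (by positivity) fun y => ?_
      have h1 := realEnvelope_sub_le hvM hL hPc y
      have h2 := hexp P.2 hP.1.le
      have h3 : 0 ≤ (L : ℝ) * ‖P.1 - y‖ := by positivity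
      calc η * Real.exp (-K * P.2) * U P - η * Real.exp (-K * P.2) * U (y, P.2)
          = η * (Real.exp (-K * P.2) * (U P - U (y, P.2))) := by ring
        _ ≤ η * (Real.exp (-K * P.2) * (L * ‖P.1 - y‖)) := by gcongr
        _ ≤ η * (1 * (L * ‖P.1 - y‖)) := by gcongr
        _ = η * L * ‖P.1 - y‖ := by ring
    have h4 : ‖p - e‖ ≤ η * L + 4 * (η * M) := (norm_sub_le _ _).trans (add_le_add hpL he)
    rw [norm_smul, Real.norm_of_nonneg (by linarith)]
    calc c * ‖p - e‖ ≤ 2 * (η * L + 4 * (η * M)) := by gcongr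
      _ = η * (2 * (L + 4 * M)) := by ring
      _ ≤ ρ := hηρ
  have hUcoe : ∀ P ∈ cylinder n T, upperEnvelope T v P = (U P : EReal) :=
    fun P hP => coe_realEnvelope hvM hP
  have hYcoe : ∀ P ∈ cylinder n T, upperEnvelope T (fun x t => -z x t) P = (Y P : EReal) :=
    fun P hP => coe_realEnvelope (u := fun x t => -z x t) hzM hP
  have hPc : ((x, t) : Space n × ℝ) ∈ cylinder n T := ⟨mem_univ _, ht.1.le, ht.2⟩
  have hUpos : 0 < U (x, t) := hpos.trans_le (le_realEnvelope hvM hPc)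
  set c := η * Real.exp (-K * t) * U (x, t) with hc
  have hc0 : 0 < c := by positivity
  -- Any `δ < c` works: `c ≤ softPlus δ r` then excludes `r ≤ 0`, where `softPlus δ r ≤ δ`.
  set δ := c / 2 with hδ_def
  have hδ : 0 < δ := half_pos hc0
  have key : c ≤ softPlus δ (-Y (x, t)) := by
    refine le_of_subsolution_of_supersolution hT hH (Good := Good) (K := Kz) (M := η * M)
      (V := fun Q => η * Real.exp (-K * Q.2) * U Q) (Z := fun Q => softPlus δ (-Y Q)) hKz
      (by positivity) ?_ ?_ ?_ (fun _ _ => softPlus_pos hδ _) ?_ ?_ ?_ hPc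
    · intro P hP y hy
      have hb : ContinuousAt (fun Q : Space n × ℝ => η * Real.exp (-K * Q.2)) P := by fun_prop
      have hb0 : 0 < η * Real.exp (-K * P.2) := by positivity
      obtain ⟨y', hy1, hy2⟩ := exists_between ((lt_div_iff₀' hb0).2 hy)
      have hb2 : ContinuousAt (fun Q : Space n × ℝ => η * Real.exp (-K * Q.2) * y') P := by fun_prop
      filter_upwards [upperSemicontinuousOn_realEnvelope hvM P hP y' hy1,
        (hb2.eventually (gt_mem_nhds ((lt_div_iff₀' hb0).1 hy2))).filter_mono
          nhdsWithin_le_nhds] with Q h1 h2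
      exact (mul_lt_mul_of_pos_left h1 (by positivity)).trans h2
    · have h1 : LowerSemicontinuousOn (fun Q => -Y Q) (cylinder n T) :=
        continuous_neg.comp_upperSemicontinuousOn_antitone
          (upperSemicontinuousOn_realEnvelope hzM) fun a b h => neg_le_neg h
      exact (continuous_softPlus δ).comp_lowerSemicontinuousOn h1 (monotone_softPlus hδ)
    · intro P hP
      have h1 := realEnvelope_le_growth hvM hP
      have h2 := hexp P.2 hP.2.1
      calc η * Real.exp (-K * P.2) * U P ≤ η * Real.exp (-K * P.2) * (M * (1 + ‖P.1‖)) := by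
            gcongr
        _ ≤ η * 1 * (M * (1 + ‖P.1‖)) := by gcongr
        _ = η * M * (1 + ‖P.1‖) := by ring
    · intro y
      have hy : ((y, 0) : Space n × ℝ) ∈ cylinder n T := ⟨mem_univ _, le_rfl, hT⟩
      have h1 : U (y, 0) = u₀ y :=
        (realEnvelope_eq_of_continuousWithinAt hvM hy (hv.continuous_initial y)).trans
          (hv.initial y)
      have h2 : Y (y, 0) = -u₀ y :=
        (realEnvelope_eq_of_continuousWithinAt hzM hy (hz.neg.continuous_initial y)).trans
          (hz.neg.initial y)
      simp only [h1, h2, neg_neg, mul_zero, Real.exp_zero, mul_one]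
      rcases le_total 0 (u₀ y) with h0 | h0
      · exact (mul_le_of_le_one_left h0 hη1).trans (le_softPlus hδ _)
      · exact (mul_nonpos_of_nonneg_of_nonpos hη0.le h0).trans (softPlus_pos hδ _).le
    · intro P hP hVP a p hj
      refine ⟨?_, hη P hP a p hj⟩
      have hb0 : 0 < η * Real.exp (-K * P.2) := by positivity
      have hUP : 0 < U P := pos_of_mul_pos_right hVP hb0.le
      have h1 := hv.sub.le_of_hasSuperjet hUcoe hP (hj.of_exp_mul hη0)
      have h2 := h1.trans (hFv _ _ _ _ hUP)
      rw [hH.homogeneous _ (inv_pos.2 hb0) _ _ ⟨hP.1.le, hP.2.le⟩, hK] at h2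
      have h3 : (η * Real.exp (-K * P.2))⁻¹ * a ≤
          (η * Real.exp (-K * P.2))⁻¹ * H₁ P.1 P.2 p - Kz * U P := by
        rw [hK]; linarith
      have h4 := mul_le_mul_of_nonneg_left h3 hb0.le
      rw [mul_sub, mul_inv_cancel_left₀ hb0.ne', mul_inv_cancel_left₀ hb0.ne'] at h4
      linarith
    · intro P hP a p hj hgood
      have hj' := hj.of_comp (W := fun Q => -Y Q) (contDiffOn_softPlusInv δ)
        (fun z hz => hasDerivAt_softPlusInv δ hz) (strictMonoOn_softPlusInv δ).monotoneOn
        (softPlus_pos hδ) (softPlusInv_softPlus hδ)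
      set s := softPlus δ (-Y P) with hs
      have hs0 : 0 < s := softPlus_pos hδ _
      set d := 1 + δ ^ 2 / s ^ 2 with hd
      have hd1 : 1 ≤ d := by rw [hd]; linarith [show 0 ≤ δ ^ 2 / s ^ 2 by positivity]
      have hd0 : 0 < d := by linarith
      unfold HasSubjet at hj'
      simp only [neg_neg] at hj'
      have h1 := hz.neg.sub.le_of_hasSuperjet hYcoe hP hj'
      rw [neg_neg] at h1
      have h2 := hFz P.1 P.2 (-Y P) (d • p) (fun h0 => hgood d hd1 (by
        have hδs : δ ≤ s := by
          rw [← softPlus_zero hδ]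
          exact monotone_softPlus hδ h0
        have : δ ^ 2 / s ^ 2 ≤ 1 := (div_le_one (by positivity)).2 (by gcongr)
        rw [hd]; linarith))
      rw [hH.homogeneous _ hd0 _ _ ⟨hP.1.le, hP.2.le⟩] at h2
      have h3 := abs_softPlusInv_le δ hs0
      rw [hs, softPlusInv_softPlus hδ, ← hs, ← hd] at h3
      have h4 := mul_le_mul_of_nonneg_left h3 hKz
      refine le_of_mul_le_mul_left ?_ hd0
      change d * (H₁ P.1 P.2 p - Kz * s) ≤ d * a
      linarith
  have hYneg : Y (x, t) < 0 := by
    by_contra! h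
    have := (monotone_softPlus hδ (neg_nonpos.2 h)).trans_eq (softPlus_zero hδ)
    linarith
  have := le_realEnvelope (u := fun x t => -z x t) hzM hPc
  simp only at this
  linarith

/-- From `w` to `u`, the lower bound on `G` is used for `r ≥ 0` and the upper bound for `r ≤ 0`; the
possibly Lipschitz `w` plays the subsolution. From `u` to `w` only the upper bound enters, so no
gradient restriction is needed. -/
theorem pos_iff_pos {H₁ : Space n → ℝ → Space n → ℝ} (hT : 0 < T)
    (hH : IsGeometricHamiltonian T H₁) {β : ℝ → ℝ} {B C : ℝ} (hB : 0 ≤ B) (hC : 0 ≤ C)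
    (hβpos : ∀ r, 0 ≤ r → 0 ≤ β r ∧ β r ≤ B * r) (hβneg : ∀ r, r ≤ 0 → B * r ≤ β r ∧ β r ≤ 0)
    {G : Space n → Space n → ℝ} (hG : ∀ x p, G x p ≤ C)
    {u₀ : Space n → ℝ} {w u : Space n → ℝ → ℝ}
    (hw : IsViscositySolution T (fun x t _ p => H₁ x t p) u₀ w)
    (hu : IsViscositySolution T (fun x t r p => H₁ x t p + β r * G x p) u₀ u)
    (hlow : (∃ C : ℝ, ∀ x p : Space n, C ≤ G x p) ∨
      ((∃ ρ : ℝ, 0 < ρ ∧ ρ ≤ 1 ∧ ∃ C : ℝ, ∀ x p : Space n, ‖p‖ ≤ ρ → C ≤ G x p) ∧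
        ∃ L : ℝ≥0, ∀ t ∈ Ico 0 T, LipschitzWith L (fun x => w x t)))
    (x : Space n) {t : ℝ} (ht : t ∈ Ioo 0 T) : 0 < w x t ↔ 0 < u x t := by
  refine ⟨fun h => ?_, fun h => ?_⟩
  · obtain ⟨D, hD⟩ : ∃ D : ℝ, (∀ p, ∀ x, D ≤ G x p) ∨
        ((∃ ρ : ℝ, 0 < ρ ∧ ∀ p, ‖p‖ ≤ ρ → ∀ x, D ≤ G x p) ∧
          ∃ L : ℝ≥0, ∀ t ∈ Ico 0 T, LipschitzWith L (fun x => w x t)) := by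
      rcases hlow with ⟨D, hD⟩ | ⟨⟨ρ, hρ, -, D, hD⟩, hL⟩
      · exact ⟨D, Or.inl fun p x => hD x p⟩
      · exact ⟨D, Or.inr ⟨⟨ρ, hρ, fun p hp x => hD x p hp⟩, hL⟩⟩
    refine pos_of_pos hT hH hw hu (Kv := 0) (Kz := B * (C + |D|)) le_rfl (by positivity)
      (Small := fun p => ∀ x, D ≤ G x p) (fun _ _ _ _ _ => by simp) ?_ hD ht h
    intro y s r p hs
    rcases le_total 0 r with hr | hr
    · obtain ⟨h1, h2⟩ := hβpos r hr
      have h3 : -(C + |D|) ≤ G y p := by linarith [hs hr y, neg_abs_le D]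
      have h4 := mul_le_mul_of_nonneg_left h3 h1
      have h5 := mul_le_mul_of_nonneg_right h2 (show 0 ≤ C + |D| by positivity)
      rw [abs_of_nonneg hr]
      linarith
    · obtain ⟨h1, h2⟩ := hβneg r hr
      have h3 : G y p ≤ C + |D| := by linarith [hG y p, abs_nonneg D]
      have h4 := mul_le_mul_of_nonpos_left h3 h2
      have h5 := mul_le_mul_of_nonneg_right h1 (show 0 ≤ C + |D| by positivity)
      rw [abs_of_nonpos hr]
      linarith
  · refine pos_of_pos hT hH hu hw (Kv := B * C) (Kz := 0) (by positivity) le_rfl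
      (Small := fun _ => True) ?_ (fun _ _ _ _ _ => by simp) (Or.inl fun _ => trivial) ht h
    intro y s r p hr
    obtain ⟨h1, h2⟩ := hβpos r hr.le
    have h4 := mul_le_mul_of_nonneg_left (hG y p) h1
    have h5 := mul_le_mul_of_nonneg_right h2 hC
    linarith

theorem IsGeometricHamiltonian.reflect {H₁ : Space n → ℝ → Space n → ℝ}
    (hH : IsGeometricHamiltonian T H₁) :
    IsGeometricHamiltonian T (fun x t p => -H₁ x t (-p)) where
  continuousOn := by
    have : ContinuousOn (fun q : Space n × ℝ × Space n => (q.1, q.2.1, -q.2.2))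
        (univ ×ˢ (Icc 0 T ×ˢ univ)) := by fun_prop
    exact (hH.continuousOn.comp this fun q hq => ⟨mem_univ _, hq.2.1, mem_univ _⟩).neg
  homogeneous c hc x t ht p := by
    rw [← smul_neg, hH.homogeneous c hc x t ht]
    ring
  lipschitz_space := by
    obtain ⟨L, hL, h⟩ := hH.lipschitz_space
    refine ⟨L, hL, fun x y t ht p hp => ?_⟩
    rw [neg_sub_neg, abs_sub_comm]
    exact h x y t ht (-p) (by rwa [norm_neg])
  lipschitz_gradient := by
    obtain ⟨L, hL, h⟩ := hH.lipschitz_gradient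
    refine ⟨L, hL, fun x t ht p q => ?_⟩
    rw [neg_sub_neg]
    refine (h x t ht (-q) (-p)).trans_eq ?_
    rw [neg_sub_neg]
  bounded_sphere := by
    obtain ⟨C, h⟩ := hH.bounded_sphere
    refine ⟨C, fun x t ht p hp => ?_⟩
    rw [abs_neg]
    exact h x t ht (-p) (by rwa [norm_neg])

end

end LevelSetFlow

/-! ### Conclusion: the negative phase by reflection, the zero set by complement. -/

open LevelSetFlow
theorem theorem3p1 (n : ℕ) (T : ℝ) (hT : 0 < T)
    (H₁ : Space n → ℝ → Space n → ℝ) (hH₁ : IsGeometricHamiltonian T H₁)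
    (β : ℝ → ℝ) (hβ : IsSmoothedSign β)
    (G : Space n → Space n → ℝ) (hG : IsCorrector G)
    (u₀ : Space n → ℝ) (hu₀ : UniformContinuous u₀)
    (w u : Space n → ℝ → ℝ)
    (hw : IsViscositySolution T (fun x t _ p => H₁ x t p) u₀ w)
    (hu : IsViscositySolution T (fun x t r p => H₁ x t p + β r * G x p) u₀ u)
    (hlow : (∃ C : ℝ, ∀ x p : Space n, C ≤ G x p) ∨
      ((∃ ρ : ℝ, 0 < ρ ∧ ρ ≤ 1 ∧ ∃ C : ℝ, ∀ x p : Space n, ‖p‖ ≤ ρ → C ≤ G x p) ∧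
        ∃ L : ℝ≥0, ∀ t ∈ Ico 0 T, LipschitzWith L (fun x => w x t))) :
    ∀ t ∈ Ioo 0 T,
      interface w t = {x | u x t = 0} ∧
      positivePhase w t = {x | 0 < u x t} ∧
      negativePhase w t = {x | u x t < 0} := by
  intro t ht
  obtain ⟨C', hC'⟩ := hG.bounded_above
  have hC : ∀ x p, G x p ≤ max C' 0 := fun x p => (hC' x p).trans (le_max_left _ _)
  obtain ⟨B, hB⟩ := hβ.lipschitz
  have habs : ∀ r, |β r| ≤ B * |r| := fun r => by
    simpa [Real.dist_eq, hβ.map_zero] using hB.dist_le_mul r 0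
  have hβpos : ∀ r, 0 ≤ r → 0 ≤ β r ∧ β r ≤ B * r := fun r hr => by
    have h := (abs_le.1 (habs r)).2
    rw [abs_of_nonneg hr] at h
    exact ⟨hβ.map_zero.symm.trans_le (hβ.mono hr), h⟩
  have hβneg : ∀ r, r ≤ 0 → B * r ≤ β r ∧ β r ≤ 0 := fun r hr => by
    have h := (abs_le.1 (habs r)).1
    rw [abs_of_nonpos hr, mul_neg, neg_neg] at h
    exact ⟨h, (hβ.mono hr).trans_eq hβ.map_zero⟩
  have hpos : ∀ x, 0 < w x t ↔ 0 < u x t := fun x =>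
    pos_iff_pos hT hH₁ B.coe_nonneg (le_max_right C' 0) hβpos hβneg hC hw hu hlow x ht
  -- Reflection replaces `β` by the map `r ↦ -β (-r)`, which obeys the same linear bounds, and `G x
  -- p` by `G x (-p)`, with the same bounds since they depend on `p` only through `‖p‖`.
  have hu' : IsViscositySolution T
      (fun x t r p => -H₁ x t (-p) + -β (-r) * G x (-p)) (fun x => -u₀ x) (fun x t => -u x t) := by
    convert hu.neg using 5
    ring
  have hneg : ∀ x, w x t < 0 ↔ u x t < 0 := fun x => by
    have := pos_iff_pos hT hH₁.reflect (β := fun r => -β (-r)) (G := fun x p => G x (-p))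
      B.coe_nonneg (le_max_right C' 0)
      (fun r hr => by
        obtain ⟨h1, h2⟩ := hβneg (-r) (by linarith)
        exact ⟨by linarith, by linarith⟩)
      (fun r hr => by
        obtain ⟨h1, h2⟩ := hβpos (-r) (by linarith)
        exact ⟨by linarith, by linarith⟩)
      (fun x p => hC x (-p)) hw.neg hu' (by
        rcases hlow with ⟨D, hD⟩ | ⟨⟨ρ, hρ, hρ1, D, hD⟩, L, hL⟩
        · exact Or.inl ⟨D, fun x p => hD x (-p)⟩
        · exact Or.inr ⟨⟨ρ, hρ, hρ1, D, fun x p hp => hD x (-p) (by rwa [norm_neg])⟩, L,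
            fun t ht => (hL t ht).neg⟩) x ht
    simpa using this
  refine ⟨?_, ?_, ?_⟩
  · ext x
    change w x t = 0 ↔ u x t = 0
    have h1 := hpos x
    have h2 := hneg x
    constructor
    · intro h
      rw [h] at h1 h2
      exact le_antisymm (not_lt.1 fun h' => lt_irrefl _ (h1.2 h'))
        (not_lt.1 fun h' => lt_irrefl _ (h2.2 h'))
    · intro h
      rw [h] at h1 h2
      exact le_antisymm (not_lt.1 fun h' => lt_irrefl _ (h1.1 h'))
        (not_lt.1 fun h' => lt_irrefl _ (h2.1 h'))
  · ext x
    exact hpos x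
  · ext x
    exact hneg x
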